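/- Let $\Bbbk$ be an at most countable totally ordered division ring and let $L$ be a distributive lattice with a least element $0$ and with at most $\aleph_1$ elements. The following are equivalent: (i) There exists a $\Bbbk$-vector lattice $E$ such that $L\cong \mathrm{Id}_c\,E$. (ii) There exists an Abelian $\ell$-group $G$ such that $L\cong \mathrm{Id}_c\,G$. (iii) $L$ is completely normal and has countably based differences. Here a $\Bbbk$-vector lattice is a left $\Bbbk$-vector space $E$ with a translation-invariant lattice order such that $\lambda x\ge 0$ whenever $\lambda\ge 0$ in $\Bbbk$ and $x\ge 0$ in $E$; an Abelian $\ell$-group is an Abelian group with a translation-invariant lattice order. With $|x|=x\vee(-x)$, $\mathrm{Id}_c\,E$ is the lattice, under inclusion, of all principal $\ell$-ideals $\langle a\rangle=\{x\in E\mid |x|\le\lambda|a|\text{ for some }\lambda\in\Bbbk,\ \lambda\ge 0\}$ with $0\le a\in E$, and $\mathrm{Id}_c\,G$ is the lattice of all $\langle a\rangle=\{x\in G\mid |x|\le n|a|\text{ for some integer }n\ge 0\}$ with $0\le a\in G$. The lattice $L$ is completely normal if for all $a,b\in L$ there are $x,y\in L$ with $a\vee b=a\vee y=x\vee b$ and $x\wedge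 y=0$. It has countably based differences if for all $a,b\in L$ there is an at most countable $C\subseteq L$ such that for every $x\in L$, $a\le b\vee x$ if and only if $c\le x$ for some $c\in C$. -/

import Mathlib

/-! Vector lattices and Abelian lattice-ordered groups are treated together, as lattice-ordered
modules `E` over a totally ordered ring `R`: a vector lattice over a totally ordered division
ring `R`, or an Abelian lattice-ordered group with its canonical `ℤ`-module structure (`R = ℤ`). -/

universe u v w z

namespace LRep

section Ideals

variable (R : Type*) {E : Type*} [Ring R] [LinearOrder R] [IsStrictOrderedRing R]
  [AddCommGroup E] [Lattice E] [Module R E] [PosSMulMono R E]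

theorem abs_smul_le (r : R) (x : E) : |r • x| ≤ |r| • |x| := by
  have key : ∀ s : R, 0 ≤ s → |s • x| ≤ s • |x| := fun s hs => by
    refine abs_le'.2 ⟨smul_le_smul_of_nonneg_left (le_abs_self x) hs, ?_⟩
    rw [← smul_neg]
    exact smul_le_smul_of_nonneg_left (neg_le_abs x) hs
  rcases le_total 0 r with h | h
  · rw [abs_of_nonneg h]
    exact key r h
  · rw [abs_of_nonpos h, ← abs_neg, ← neg_smul]
    exact key (-r) (neg_nonneg.2 h)

variable [IsOrderedAddMonoid E]

/-- The principal `ℓ`-ideal `⟨a⟩ = {x ∈ E | ∃ r ∈ R⁺, |x| ≤ r |a|}`. -/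
def principalLIdeal (a : E) : Submodule R E where
  carrier := {x | ∃ r : R, 0 ≤ r ∧ |x| ≤ r • |a|}
  zero_mem' := ⟨0, le_rfl, by simp⟩
  add_mem' := by
    rintro x y ⟨r, hr, hx⟩ ⟨s, hs, hy⟩
    refine ⟨r + s, add_nonneg hr hs, (abs_add_le x y).trans ?_⟩
    rw [add_smul]
    exact add_le_add hx hy
  smul_mem' := by
    rintro c x ⟨r, hr, hx⟩
    refine ⟨|c| * r, mul_nonneg (abs_nonneg c) hr, (abs_smul_le R c x).trans ?_⟩
    rw [mul_smul]
    exact smul_le_smul_of_nonneg_left hx (abs_nonneg c)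

/-- `ℓ`-ideals: linear subspaces (for `R = ℤ`: subgroups) that are closed under the lattice
operations and order-convex. -/
def IsLIdeal (I : Submodule R E) : Prop :=
  (∀ x ∈ I, ∀ y ∈ I, x ⊔ y ∈ I ∧ x ⊓ y ∈ I) ∧ (I : Set E).OrdConnected

/-- `⟨a⟩` is the `ℓ`-ideal generated by `a`. -/
theorem isLeast_principalLIdeal (a : E) :
    IsLeast {I : Submodule R E | IsLIdeal R I ∧ a ∈ I} (principalLIdeal R a) := by
  have solid : ∀ x ∈ principalLIdeal R a, ∀ y : E, |y| ≤ |x| → y ∈ principalLIdeal R a := by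
    rintro x ⟨r, hr, hx⟩ y hy
    exact ⟨r, hr, hy.trans hx⟩
  have habs : ∀ x ∈ principalLIdeal R a, |x| ∈ principalLIdeal R a :=
    fun x hx => solid x hx _ (by rw [abs_abs])
  have conv : ∀ x ∈ principalLIdeal R a, ∀ y ∈ principalLIdeal R a, ∀ z : E, x ≤ z → z ≤ y →
      z ∈ principalLIdeal R a := by
    intro x hx y hy z hxz hzy
    refine solid _ (add_mem (habs x hx) (habs y hy)) z ?_
    rw [abs_of_nonneg (add_nonneg (abs_nonneg x) (abs_nonneg y))]
    refine abs_le'.2 ⟨?_, ?_⟩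
    · exact (hzy.trans (le_abs_self y)).trans (le_add_of_nonneg_left (abs_nonneg x))
    · exact ((neg_le_neg hxz).trans (neg_le_abs x)).trans
        (le_add_of_nonneg_right (abs_nonneg y))
  refine ⟨⟨⟨fun x hx y hy => ⟨?_, ?_⟩, ⟨fun x hx y hy z hz => conv x hx y hy z hz.1 hz.2⟩⟩,
    1, zero_le_one, by rw [one_smul]⟩, ?_⟩
  · refine conv x hx _ (add_mem (habs x hx) (habs y hy)) _ le_sup_left (sup_le ?_ ?_)
    · exact (le_abs_self x).trans (le_add_of_nonneg_right (abs_nonneg y))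
    · exact (le_abs_self y).trans (le_add_of_nonneg_left (abs_nonneg x))
  · refine conv _ (neg_mem (add_mem (habs x hx) (habs y hy))) x hx _ (le_inf ?_ ?_) inf_le_left
    · exact neg_le.1 ((neg_le_abs x).trans (le_add_of_nonneg_right (abs_nonneg y)))
    · exact neg_le.1 ((neg_le_abs y).trans (le_add_of_nonneg_left (abs_nonneg x)))
  · rintro I ⟨⟨hl, hc⟩, ha⟩ x ⟨r, -, hx⟩
    have h : r • |a| ∈ I := I.smul_mem r (hl a ha (-a) (I.neg_mem ha)).1
    exact hc.out (I.neg_mem h) h ⟨neg_le.1 ((neg_le_abs x).trans hx), (le_abs_self x).trans hx⟩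

variable (E) in
/-- `Id_c E = {⟨a⟩ | a ∈ E⁺}`, the principal `ℓ`-ideals of `E`, ordered by inclusion.
For an Abelian lattice-ordered group `G`, `Id_c G` is `Idc ℤ G`. -/
def Idc : Set (Submodule R E) :=
  {I | ∃ a : E, 0 ≤ a ∧ I = principalLIdeal R a}

end Ideals

/-- Complete normality of a lattice with zero. -/
def IsCompletelyNormal (L : Type*) [Lattice L] [OrderBot L] : Prop :=
  ∀ a b : L, ∃ x y : L, a ⊔ b = a ⊔ y ∧ a ⊔ b = x ⊔ b ∧ x ⊓ y = ⊥

/-- Countably based differences (countable means at most countable). -/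
def HasCountablyBasedDifferences (L : Type*) [Lattice L] : Prop :=
  ∀ a b : L, ∃ C : Set L, C.Countable ∧ ∀ x : L, a ≤ b ⊔ x ↔ ∃ c ∈ C, c ≤ x

end LRep

set_option linter.unusedSectionVars false

/-! Necessity is direct. In a vector lattice or Abelian ℓ-group, `⟨a - a ⊓ b⟩` and `⟨b - a ⊓ b⟩`
witness complete normality, and the ideals `⟨(a - r • b) ⊔ 0⟩`, with `r ≥ 0` in the countable scalar
ring, form a base of the difference of `⟨a⟩` and `⟨b⟩`.

For sufficiency, `a ↦ ⟨a⁺⟩` acts on a vector lattice like an `L`-valued truth value of `a > 0`.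
Conversely, let `φ` be a positivity map on a vector space in which every vector has a positive part
as seen by `φ`. Dividing by the kernel gives a vector lattice. Closedness at `c = ⊥` says that `φ a
≤ φ b` forces `a ≤ r • b`, so `φ` identifies `Id_c` with `L` once nonnegative vectors attain every
value (`exists_vectorLattice`).

Such a `φ` is built on the free space over `ω₁`, one basis vector at a time. Extending `φ` from `W`
to a new vector `y` means choosing truth values of `y > a` and `y < a` for `a ∈ W`, that is, a cut.
Complete normality extends a finite cut by one point (`exists_extend_values`). Closedness of `φ` on
`W`, for all `c`, makes it possible to choose that point so that a given instance of closedness will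
hold for the extension. Each `W` is countable, and countably based differences leave only countably
many instances, so a Rasiowa–Sikorski argument produces the whole cut (`FinCut.exists_isClosedCut`).
Every `c : L` and every vector recurs cofinally in `ω₁` as a task, to be realized as a value or to
receive a positive part.

For ℓ-groups the construction is run over `ℚ`, where integer and rational multiples generate the
same ideals. -/

namespace LRep

/-! ### Positivity maps, cuts, and one-point extension of a finite cut -/

section PositivityMaps

variable {k : Type*} [DivisionRing k] [LinearOrder k] [IsStrictOrderedRing k]
  {V : Type*} [AddCommGroup V] [Module k V] {L : Type*} [DistribLattice L] [OrderBot L]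

/-- A map `φ : V → L` whose value at `a` behaves on the subspace `W` like the truth value of
`a > 0` for an `L`-valued total vector preorder. -/
structure IsPositivityMap (W : Submodule k V) (φ : V → L) : Prop where
  inf_neg : ∀ a ∈ W, φ a ⊓ φ (-a) = ⊥
  smul : ∀ r : k, 0 < r → ∀ a ∈ W, φ (r • a) = φ a
  add_le : ∀ a ∈ W, ∀ b ∈ W, φ (a + b) ≤ φ a ⊔ φ b

/-- An archimedean-type condition on positivity maps: modulo `c`, if `q ≥ 0` and `q > 0` whenever
`p > 0`, then `p` is dominated by a multiple of `q`. -/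
def IsClosedMap (W : Submodule k V) (φ : V → L) : Prop :=
  ∀ p ∈ W, ∀ q ∈ W, ∀ c, φ (-q) ≤ c → φ p ≤ φ q ⊔ c → ∃ r : k, φ (p - r • q) ≤ c

namespace IsPositivityMap

variable {W : Submodule k V} {φ : V → L} (hφ : IsPositivityMap W φ)
include hφ

theorem map_zero : φ 0 = ⊥ := by
  simpa using hφ.inf_neg 0 W.zero_mem

theorem smul_le {r : k} (hr : 0 ≤ r) {a : V} (ha : a ∈ W) : φ (r • a) ≤ φ a := by
  rcases hr.eq_or_lt with rfl | h
  · simp [hφ.map_zero]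
  · exact (hφ.smul r h a ha).le

theorem le_of_eq_add {a b c : V} (hb : b ∈ W) (hc : c ∈ W) (h : a = b + c) : φ a ≤ φ b ⊔ φ c :=
  h ▸ hφ.add_le b hb c hc

theorem sub_smul_le {p q : V} (hp : p ∈ W) (hq : q ∈ W) {r s : k} (hrs : r ≤ s) :
    φ (p - s • q) ≤ φ (p - r • q) ⊔ φ (-q) := by
  have h1 : φ (p - s • q) ≤ φ (p - r • q) ⊔ φ ((s - r) • (-q)) :=
    hφ.le_of_eq_add (W.sub_mem hp (W.smul_mem _ hq)) (W.smul_mem _ (W.neg_mem hq))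
      (by rw [smul_neg, sub_smul]; abel)
  exact h1.trans (sup_le_sup_left (hφ.smul_le (sub_nonneg.2 hrs) (W.neg_mem hq)) _)

end IsPositivityMap

/-- Since `q ≥ 0` modulo `c`, raising an admissible scalar keeps it admissible. This is what allows
one scalar to serve finitely many instances at once. -/
theorem IsClosedMap.exists_pos {W : Submodule k V} {φ : V → L} (hc : IsClosedMap W φ)
    (hφ : IsPositivityMap W φ) {p q : V} (hp : p ∈ W) (hq : q ∈ W) {c : L} (hqc : φ (-q) ≤ c)
    (hpq : φ p ≤ φ q ⊔ c) : ∃ r₀ : k, 0 < r₀ ∧ ∀ r, r₀ ≤ r → φ (p - r • q) ≤ c := by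
  obtain ⟨r, hr⟩ := hc p hp q hq c hqc hpq
  refine ⟨max r 1, lt_max_of_lt_right one_pos, fun s hs => ?_⟩
  exact (hφ.sub_smul_le hp hq ((le_max_left _ _).trans hs)).trans (sup_le hr hqc)

/-- `U a` and `D a` behave like the truth values of `y > a` and `y < a`, for `a ∈ S` and some new
element `y`. -/
structure IsCut (φ : V → L) (S : Set V) (U D : V → L) : Prop where
  inf_eq : ∀ a ∈ S, U a ⊓ D a = ⊥
  le_sup : ∀ a ∈ S, ∀ b ∈ S, φ (b - a) ≤ U a ⊔ D b
  up_le : ∀ a ∈ S, ∀ b ∈ S, U a ≤ U b ⊔ φ (b - a)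
  down_le : ∀ a ∈ S, ∀ b ∈ S, D a ≤ D b ⊔ φ (a - b)

theorem IsCut.neg {φ : V → L} {S : Set V} {U D : V → L} (h : IsCut φ S U D) :
    IsCut φ {a | -a ∈ S} (fun a => D (-a)) (fun a => U (-a)) where
  inf_eq a ha := by rw [inf_comm]; exact h.inf_eq _ ha
  le_sup a ha b hb := by
    rw [sup_comm]; simpa [add_comm, sub_eq_add_neg] using h.le_sup _ hb _ ha
  up_le a ha b hb := by simpa [add_comm, sub_eq_add_neg] using h.down_le _ ha _ hb
  down_le a ha b hb := by simpa [add_comm, sub_eq_add_neg] using h.up_le _ ha _ hb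

/-- `c` bounds the region where `y > e` is forced by the cut. -/
def UpBound (φ : V → L) (S : Set V) (U D : V → L) (e : V) (c : L) : Prop :=
  ∀ i ∈ S, φ (i - e) ≤ D i ⊔ c ∧ U i ≤ φ (e - i) ⊔ c

/-- `c` bounds the region where `y < e` is forced by the cut. -/
def DownBound (φ : V → L) (S : Set V) (U D : V → L) (e : V) (c : L) : Prop :=
  ∀ i ∈ S, φ (e - i) ≤ U i ⊔ c ∧ D i ≤ φ (i - e) ⊔ c

theorem UpBound.inf {φ : V → L} {S : Set V} {U D : V → L} {e : V} {c d : L}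
    (hc : UpBound φ S U D e c) (hd : UpBound φ S U D e d) : UpBound φ S U D e (c ⊓ d) :=
  fun i hi => ⟨by rw [sup_inf_left]; exact le_inf (hc i hi).1 (hd i hi).1,
    by rw [sup_inf_left]; exact le_inf (hc i hi).2 (hd i hi).2⟩

theorem DownBound.inf {φ : V → L} {S : Set V} {U D : V → L} {e : V} {c d : L}
    (hc : DownBound φ S U D e c) (hd : DownBound φ S U D e d) : DownBound φ S U D e (c ⊓ d) :=
  fun i hi => ⟨by rw [sup_inf_left]; exact le_inf (hc i hi).1 (hd i hi).1,
    by rw [sup_inf_left]; exact le_inf (hc i hi).2 (hd i hi).2⟩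

theorem sup_finset_inf' {ι : Type*} {s : Finset ι} (hs : s.Nonempty) (f : ι → L) (a b : L)
    (h : ∀ i ∈ s, a ≤ b ⊔ f i) : a ≤ b ⊔ s.inf' hs f :=
  Finset.inf'_induction hs f (p := fun x => a ≤ b ⊔ x)
    (fun x hx y hy => by rw [sup_inf_left]; exact le_inf hx hy) h

/-- Chaining gives `a ≤ s ⊔ x ⊔ t`, and `a` is disjoint from `t`. It shows that the lower bounds
satisfied by `A` survive when complete normality replaces `A` by a smaller `x`. -/
theorem le_sup_of_sup_eq {a s t x A B : L} (h1 : a ≤ s ⊔ A) (h2 : A ≤ x ⊔ B)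
    (h3 : B ≤ s ⊔ t) (h4 : a ⊓ t = ⊥) : a ≤ s ⊔ x := by
  refine Disjoint.left_le_of_le_sup_right
    (h1.trans (sup_le ?_ (h2.trans (sup_le ?_ ?_)))) (disjoint_iff.2 h4)
  · exact le_sup_of_le_left le_sup_left
  · exact le_sup_of_le_left le_sup_right
  · exact h3.trans (sup_le_sup_right le_sup_left _)

section Extend

variable {W : Submodule k V} {φ : V → L} (hφ : IsPositivityMap W φ)
  {S : Finset V} (hS : S.Nonempty) (hSW : ∀ a ∈ S, a ∈ W) {U D : V → L}
  (h : IsCut φ S U D) {e : V} (he : e ∈ W)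
include hφ hSW h he

/-- The largest possible truth value of `y > e`. -/
theorem upBound_inf' : UpBound φ S U D e (S.inf' hS fun i => U i ⊔ φ (i - e)) := by
  intro b hb
  refine ⟨sup_finset_inf' hS _ _ _ fun i hi => ?_, sup_finset_inf' hS _ _ _ fun i hi => ?_⟩
  · have h1 := h.le_sup i hi b hb
    have h2 := hφ.le_of_eq_add (a := b - e) (b := b - i) (c := i - e)
      (W.sub_mem (hSW b hb) (hSW i hi)) (W.sub_mem (hSW i hi) he) (by abel)
    refine h2.trans (sup_le (h1.trans ?_) ?_)
    · exact sup_le (le_sup_of_le_right le_sup_left) le_sup_left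
    · exact le_sup_of_le_right le_sup_right
  · have h1 := h.up_le b hb i hi
    have h2 := hφ.le_of_eq_add (a := i - b) (b := e - b) (c := i - e)
      (W.sub_mem he (hSW b hb)) (W.sub_mem (hSW i hi) he) (by abel)
    refine h1.trans (sup_le (le_sup_of_le_right le_sup_left) (h2.trans ?_))
    exact sup_le_sup_left le_sup_right _

theorem downBound_inf' : DownBound φ S U D e (S.inf' hS fun i => D i ⊔ φ (e - i)) := by
  intro b hb
  refine ⟨sup_finset_inf' hS _ _ _ fun i hi => ?_, sup_finset_inf' hS _ _ _ fun i hi => ?_⟩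
  · have h1 := h.le_sup b hb i hi
    have h2 := hφ.le_of_eq_add (a := e - b) (b := e - i) (c := i - b)
      (W.sub_mem he (hSW i hi)) (W.sub_mem (hSW i hi) (hSW b hb)) (by abel)
    refine h2.trans (sup_le ?_ (h1.trans ?_))
    · exact le_sup_of_le_right le_sup_right
    · exact sup_le_sup_left le_sup_left _
  · have h1 := h.down_le b hb i hi
    have h2 := hφ.le_of_eq_add (a := b - i) (b := b - e) (c := e - i)
      (W.sub_mem (hSW b hb) he) (W.sub_mem he (hSW i hi)) (by abel)
    refine h1.trans (sup_le (le_sup_of_le_right le_sup_left) (h2.trans ?_))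
    exact sup_le_sup_left le_sup_right _

include hS in
/-- Admissible truth values of `y > e` and `y < e`, with prescribed bounds. -/
theorem exists_extend_values (hL : IsCompletelyNormal L) {c d : L} (hc : UpBound φ S U D e c)
    (hd : DownBound φ S U D e d) : ∃ u v : L, u ≤ c ∧ v ≤ d ∧ u ⊓ v = ⊥ ∧
      UpBound φ S U D e u ∧ DownBound φ S U D e v ∧
      (∀ i ∈ S, u ≤ U i ⊔ φ (i - e)) ∧ ∀ i ∈ S, v ≤ D i ⊔ φ (e - i) := by
  set A := S.inf' hS fun i => U i ⊔ φ (i - e) with hA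
  set B := S.inf' hS fun i => D i ⊔ φ (e - i) with hB
  have hAi : ∀ i ∈ S, A ≤ U i ⊔ φ (i - e) := fun i hi => Finset.inf'_le _ hi
  have hBi : ∀ i ∈ S, B ≤ D i ⊔ φ (e - i) := fun i hi => Finset.inf'_le _ hi
  obtain ⟨x, y, hy, hx, hxy⟩ := hL A B
  have hUA := upBound_inf' hφ hS hSW h he
  have hDB := downBound_inf' hφ hS hSW h he
  have neg : ∀ i ∈ S, φ (i - e) ⊓ φ (e - i) = ⊥ := fun i hi => by
    simpa using hφ.inf_neg (i - e) (W.sub_mem (hSW i hi) he)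
  have hUx : UpBound φ S U D e x := fun i hi =>
    ⟨le_sup_of_sup_eq (hUA i hi).1 (hx ▸ le_sup_left) (hBi i hi) (neg i hi),
      le_sup_of_sup_eq (hUA i hi).2 (hx ▸ le_sup_left) ((hBi i hi).trans_eq (sup_comm _ _))
        (h.inf_eq i hi)⟩
  have hDy : DownBound φ S U D e y := fun i hi =>
    ⟨le_sup_of_sup_eq (hDB i hi).1 (sup_comm A y ▸ hy ▸ le_sup_right) (hAi i hi)
        (inf_comm (φ (i - e)) _ ▸ neg i hi),
      le_sup_of_sup_eq (hDB i hi).2 (sup_comm A y ▸ hy ▸ le_sup_right)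
        ((hAi i hi).trans_eq (sup_comm _ _)) (inf_comm (U i) _ ▸ h.inf_eq i hi)⟩
  -- Bounds are stable under meets, so one may cut down by `A` and `B` (consistency with the old
  -- points) and by the prescribed `c` and `d`.
  refine ⟨x ⊓ A ⊓ c, y ⊓ B ⊓ d, inf_le_right, inf_le_right, ?_, (hUx.inf hUA).inf hc,
    (hDy.inf hDB).inf hd, fun i hi => ?_, fun i hi => ?_⟩
  · rw [eq_bot_iff, ← hxy]
    exact inf_le_inf (inf_le_left.trans inf_le_left) (inf_le_left.trans inf_le_left)
  · exact inf_le_left.trans (inf_le_right.trans (hAi i hi))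
  · exact inf_le_left.trans (inf_le_right.trans (hBi i hi))

end Extend

end PositivityMaps

/-! ### Choosing the new point so that closedness survives -/

section Tasks

variable {k : Type*} [DivisionRing k] [LinearOrder k] [IsStrictOrderedRing k]
  {V : Type*} [AddCommGroup V] [Module k V] {L : Type*} [DistribLattice L] [OrderBot L]
  {W : Submodule k V} {φ : V → L}

/-- The two consecutive scalars leave a gap of one: below, `r + 1` gives one inequality of a bound,
and the other compares the multiples by `r` and `r + 1`. -/
theorem exists_uniform_scalar (S : Finset V) {P : V → k → Prop}
    (h : ∀ i ∈ S, ∃ r₀ : k, 0 < r₀ ∧ ∀ r, r₀ ≤ r → P i r) :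
    ∃ r : k, 0 < r ∧ ∀ i ∈ S, P i r ∧ P i (r + 1) := by
  choose! f hf hP using h
  refine ⟨1 + ∑ i ∈ S, f i, ?_, fun i hi => ?_⟩
  · exact add_pos_of_pos_of_nonneg one_pos (Finset.sum_nonneg fun i hi => (hf i hi).le)
  · have h1 : f i ≤ 1 + ∑ i ∈ S, f i :=
      (Finset.single_le_sum (fun i hi => (hf i hi).le) hi).trans
        (le_add_of_nonneg_left zero_le_one)
    exact ⟨hP i hi _ h1, hP i hi _ (h1.trans (le_add_of_nonneg_right zero_le_one))⟩

variable (hφ : IsPositivityMap W φ) (hcl : IsClosedMap W φ) {S : Finset V}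
  (hSW : ∀ a ∈ S, a ∈ W) {U D : V → L} (h : IsCut φ S U D)
include hφ hcl hSW h

/-- If `y - b ≥ 0` dominates `a` modulo `c`, then `y < b + s a` may be bounded by `c` for some
`s > 0`. -/
theorem exists_downBound {a b : V} (ha : a ∈ W) (hb : b ∈ S) {c : L} (hbc : D b ≤ c)
    (hab : φ a ≤ U b ⊔ c) : ∃ s : k, 0 < s ∧ DownBound φ S U D (b + s • a) c := by
  have key : ∀ i ∈ S, ∃ r₀ : k, 0 < r₀ ∧ ∀ r, r₀ ≤ r → φ (a - r • (i - b)) ≤ U i ⊔ c := by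
    intro i hi
    refine hcl.exists_pos hφ ha (W.sub_mem (hSW i hi) (hSW b hb)) ?_ ?_
    · rw [neg_sub]
      exact (h.le_sup i hi b hb).trans (sup_le_sup_left hbc _)
    · refine hab.trans (sup_le ((h.up_le b hb i hi).trans ?_) (le_sup_of_le_right le_sup_right))
      exact sup_le (le_sup_of_le_right le_sup_left) le_sup_left
  obtain ⟨r, hr, hrS⟩ := exists_uniform_scalar S key
  have hr1 : 0 < r + 1 := add_pos hr one_pos
  -- With `e = b + (r + 1)⁻¹ • a`, the identity `i - b = (r + 1) • (i - e) + (a - r • (i - b))`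
  -- yields the second inequality up to a term `U i`, which is disjoint from `D i`.
  refine ⟨(r + 1)⁻¹, inv_pos.2 hr1, fun i hi => ⟨?_, ?_⟩⟩
  · have e1 : (r + 1) • (b + (r + 1)⁻¹ • a - i) = a - (r + 1) • (i - b) := by
      rw [smul_sub, smul_add, smul_inv_smul₀ hr1.ne', smul_sub]; abel
    rw [← hφ.smul (r + 1) hr1 _ (W.sub_mem (W.add_mem (hSW b hb) (W.smul_mem _ ha)) (hSW i hi)),
      e1]
    exact (hrS i hi).2
  · have e1 : (r + 1) • (i - (b + (r + 1)⁻¹ • a)) = (r + 1) • (i - b) - a := by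
      rw [smul_sub, smul_add, smul_inv_smul₀ hr1.ne', smul_sub]; abel
    have m1 := W.sub_mem (hSW i hi) (W.add_mem (hSW b hb) (W.smul_mem (r + 1)⁻¹ ha))
    have m2 := W.sub_mem (hSW i hi) (hSW b hb)
    have h1 : φ (i - b) ≤ φ (i - (b + (r + 1)⁻¹ • a)) ⊔ φ (a - r • (i - b)) := by
      rw [← hφ.smul (r + 1) hr1 _ m1]
      refine hφ.le_of_eq_add (W.smul_mem _ m1) (W.sub_mem ha (W.smul_mem _ m2)) ?_
      rw [e1, add_smul, one_smul]; abel
    have h2 : D i ≤ φ (i - (b + (r + 1)⁻¹ • a)) ⊔ c ⊔ U i := by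
      refine (h.down_le i hi b hb).trans (sup_le (hbc.trans ?_) (h1.trans (sup_le ?_ ?_)))
      · exact le_sup_of_le_left le_sup_right
      · exact le_sup_of_le_left le_sup_left
      · exact (hrS i hi).1.trans (sup_le le_sup_right (le_sup_of_le_left le_sup_right))
    exact Disjoint.left_le_of_le_sup_right h2
      (disjoint_iff.2 ((inf_comm _ _).trans (h.inf_eq i hi)))

/-- If `q ≥ 0` dominates `y - b` modulo `c`, then `y > b + r q` may be bounded by `c` for some
`r`. -/
theorem exists_upBound {q b : V} (hq : q ∈ W) (hb : b ∈ S) {c : L} (hqc : φ (-q) ≤ c)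
    (hbq : U b ≤ φ q ⊔ c) : ∃ r : k, UpBound φ S U D (b + r • q) c := by
  have key : ∀ i ∈ S, ∃ r₀ : k, 0 < r₀ ∧ ∀ r, r₀ ≤ r → φ (i - b - r • q) ≤ D i ⊔ c := by
    intro i hi
    refine hcl.exists_pos hφ (W.sub_mem (hSW i hi) (hSW b hb)) hq (le_sup_of_le_right hqc) ?_
    refine (h.le_sup b hb i hi).trans (sup_le (hbq.trans (sup_le_sup_left le_sup_right _)) ?_)
    exact le_sup_of_le_right le_sup_left
  obtain ⟨r, hr, hrS⟩ := exists_uniform_scalar S key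
  have hr1 : 0 < r + 1 := add_pos hr one_pos
  refine ⟨r + 1, fun i hi => ⟨?_, ?_⟩⟩
  · rw [← sub_sub]
    exact (hrS i hi).2
  · have m0 := W.sub_mem (hSW b hb) (hSW i hi)
    have m1 : b + (r + 1) • q - i ∈ W :=
      W.sub_mem (W.add_mem (hSW b hb) (W.smul_mem _ hq)) (hSW i hi)
    have m2 : i - b - r • q ∈ W := W.sub_mem (W.sub_mem (hSW i hi) (hSW b hb)) (W.smul_mem _ hq)
    -- The gap between `r` and `r + 1` recovers exactly one copy of `q`.
    have h1 : φ q ≤ φ (i - b - r • q) ⊔ φ (b + (r + 1) • q - i) :=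
      hφ.le_of_eq_add m2 m1 (by rw [add_smul, one_smul]; abel)
    have h2 : φ (b - i) ≤ φ (b + (r + 1) • q - i) ⊔ φ (-q) := by
      refine (hφ.le_of_eq_add m1 (W.smul_mem (r + 1) (W.neg_mem hq)) ?_).trans
        (sup_le_sup_left (hφ.smul_le hr1.le (W.neg_mem hq)) _)
      rw [smul_neg]; abel
    have h3 := (h.up_le i hi b hb)
    have h4 : U i ≤ φ (b + (r + 1) • q - i) ⊔ c ⊔ D i := by
      refine h3.trans (sup_le (hbq.trans (sup_le (h1.trans (sup_le ?_ ?_)) ?_))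
        (h2.trans (sup_le ?_ (hqc.trans ?_))))
      · exact (hrS i hi).1.trans (sup_le le_sup_right (le_sup_of_le_left le_sup_right))
      · exact le_sup_of_le_left le_sup_left
      · exact le_sup_of_le_left le_sup_right
      · exact le_sup_of_le_left le_sup_left
      · exact le_sup_of_le_left le_sup_right
    exact Disjoint.left_le_of_le_sup_right h4 (disjoint_iff.2 (h.inf_eq i hi))

end Tasks

/-! ### Generic cuts of a countable subspace -/

section Generic

variable {k : Type*} [DivisionRing k] [LinearOrder k] [IsStrictOrderedRing k]
  {V : Type*} [AddCommGroup V] [Module k V] {L : Type*} [DistribLattice L] [OrderBot L]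

/-- Finite partial cuts of the subspace `W`, ordered by extension. -/
structure FinCut (W : Submodule k V) (φ : V → L) where
  dom : Finset V
  nonempty : dom.Nonempty
  mem : ∀ a ∈ dom, a ∈ W
  up : V → L
  down : V → L
  isCut : IsCut φ dom up down

namespace FinCut

variable {W : Submodule k V} {φ : V → L}

instance : Preorder (FinCut W φ) where
  le C C' := C.dom ⊆ C'.dom ∧ ∀ a ∈ C.dom, C'.up a = C.up a ∧ C'.down a = C.down a
  le_refl C := ⟨subset_rfl, fun a _ => ⟨rfl, rfl⟩⟩
  le_trans A B C h h' := ⟨h.1.trans h'.1, fun a ha =>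
    ⟨((h'.2 a (h.1 ha)).1).trans (h.2 a ha).1, ((h'.2 a (h.1 ha)).2).trans (h.2 a ha).2⟩⟩

open Classical in
/-- The mirror image of a cut. -/
noncomputable def neg (C : FinCut W φ) : FinCut W φ where
  dom := C.dom.image (fun a => -a)
  nonempty := C.nonempty.image _
  mem a ha := by
    obtain ⟨b, hb, rfl⟩ := Finset.mem_image.1 ha
    exact W.neg_mem (C.mem b hb)
  up a := C.down (-a)
  down a := C.up (-a)
  isCut := by
    convert C.isCut.neg using 1
    ext a
    simp only [Finset.coe_image, Set.mem_image, Finset.mem_coe]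
    exact ⟨by rintro ⟨b, hb, rfl⟩; simpa using hb, fun ha => ⟨-a, ha, neg_neg a⟩⟩

theorem mem_neg_dom {C : FinCut W φ} {a : V} : a ∈ C.neg.dom ↔ -a ∈ C.dom := by
  simp only [neg, Finset.mem_image]
  exact ⟨by rintro ⟨b, hb, rfl⟩; simpa using hb, fun ha => ⟨-a, ha, neg_neg a⟩⟩

theorem le_neg_of_neg_le {C C' : FinCut W φ} (h : C.neg ≤ C') : C ≤ C'.neg := by
  refine ⟨fun a ha => mem_neg_dom.2 (h.1 (mem_neg_dom.2 (by simpa using ha))), fun a ha => ?_⟩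
  have := h.2 (-a) (mem_neg_dom.2 (by simpa using ha))
  exact ⟨this.2.trans (by simp [neg]), this.1.trans (by simp [neg])⟩

open Classical in
theorem exists_extend (hφ : IsPositivityMap W φ) (hL : IsCompletelyNormal L) (C : FinCut W φ)
    {e : V} (he : e ∈ W) {c d : L} (hc : UpBound φ C.dom C.up C.down e c)
    (hd : DownBound φ C.dom C.up C.down e d) :
    ∃ C' : FinCut W φ, C ≤ C' ∧ e ∈ C'.dom ∧ C'.up e ≤ c ∧ C'.down e ≤ d := by
  -- If `e` is already decided, the bounds at `i = e` involve only `φ 0 = ⊥`, so the existing values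
  -- obey `c` and `d`.
  by_cases heC : e ∈ C.dom
  · refine ⟨C, le_rfl, heC, ?_, ?_⟩
    · simpa [hφ.map_zero] using (hc e heC).2
    · simpa [hφ.map_zero] using (hd e heC).2
  obtain ⟨u, v, huc, hvd, huv, hu, hv, hu', hv'⟩ :=
    exists_extend_values hφ C.nonempty C.mem C.isCut he hL hc hd
  have ne : ∀ a ∈ C.dom, a ≠ e := fun a ha hae => heC (hae ▸ ha)
  have hcut := C.isCut
  refine ⟨⟨insert e C.dom, Finset.insert_nonempty _ _, ?_, Function.update C.up e u,
    Function.update C.down e v, ?_⟩, ⟨Finset.subset_insert _ _, fun a ha => ?_⟩,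
    Finset.mem_insert_self _ _, by simpa using huc, by simpa using hvd⟩
  · intro a ha
    rcases Finset.mem_insert.1 ha with rfl | ha
    exacts [he, C.mem a ha]
  · constructor
    · intro a ha
      rcases Finset.mem_insert.1 ha with rfl | ha'
      · simpa using huv
      · simpa [ne a ha'] using hcut.inf_eq a ha'
    · intro a ha b hb
      rcases Finset.mem_insert.1 ha with rfl | ha' <;> rcases Finset.mem_insert.1 hb with rfl | hb'
      · simp [hφ.map_zero]
      · simpa [ne b hb', sup_comm] using (hu b hb').1
      · simpa [ne a ha', sup_comm] using (hv a ha').1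
      · simpa [ne a ha', ne b hb'] using hcut.le_sup a ha' b hb'
    · intro a ha b hb
      rcases Finset.mem_insert.1 ha with rfl | ha' <;> rcases Finset.mem_insert.1 hb with rfl | hb'
      · simp
      · simpa [ne b hb'] using hu' b hb'
      · simpa [ne a ha', sup_comm] using (hu a ha').2
      · simpa [ne a ha', ne b hb'] using hcut.up_le a ha' b hb'
    · intro a ha b hb
      rcases Finset.mem_insert.1 ha with rfl | ha' <;> rcases Finset.mem_insert.1 hb with rfl | hb'
      · simp
      · simpa [ne b hb'] using hv' b hb'
      · simpa [ne a ha', sup_comm] using (hv a ha').2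
      · simpa [ne a ha', ne b hb'] using hcut.down_le a ha' b hb'
  · simp [ne a ha]

theorem exists_mem_dom (hφ : IsPositivityMap W φ) (hL : IsCompletelyNormal L) (C : FinCut W φ)
    {e : V} (he : e ∈ W) : ∃ C' : FinCut W φ, C ≤ C' ∧ e ∈ C'.dom := by
  obtain ⟨C', h, h', -⟩ := C.exists_extend hφ hL he
    (upBound_inf' hφ C.nonempty C.mem C.isCut he) (downBound_inf' hφ C.nonempty C.mem C.isCut he)
  exact ⟨C', h, h'⟩

variable (hφ : IsPositivityMap W φ) (hcl : IsClosedMap W φ) (hL : IsCompletelyNormal L)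
include hφ hcl hL

theorem exists_down_le (C : FinCut W φ) {a b : V} (ha : a ∈ W) (hb : b ∈ C.dom) {c : L}
    (hbc : C.down b ≤ c) (hab : φ a ≤ C.up b ⊔ c) : ∃ C' : FinCut W φ, C ≤ C' ∧
      ∃ s : k, 0 < s ∧ b + s • a ∈ C'.dom ∧ C'.down (b + s • a) ≤ c := by
  obtain ⟨s, hs, hd⟩ := exists_downBound hφ hcl C.mem C.isCut ha hb hbc hab
  have he := W.add_mem (C.mem b hb) (W.smul_mem s ha)
  obtain ⟨C', h, h', -, h''⟩ := C.exists_extend hφ hL he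
    (upBound_inf' hφ C.nonempty C.mem C.isCut he) hd
  exact ⟨C', h, s, hs, h', h''⟩

theorem exists_up_le (C : FinCut W φ) {q b : V} (hq : q ∈ W) (hb : b ∈ C.dom) {c : L}
    (hqc : φ (-q) ≤ c) (hbq : C.up b ≤ φ q ⊔ c) : ∃ C' : FinCut W φ, C ≤ C' ∧
      ∃ r : k, b + r • q ∈ C'.dom ∧ C'.up (b + r • q) ≤ c := by
  obtain ⟨r, hd⟩ := exists_upBound hφ hcl C.mem C.isCut hq hb hqc hbq
  have he := W.add_mem (C.mem b hb) (W.smul_mem r hq)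
  obtain ⟨C', h, h', h'', -⟩ := C.exists_extend hφ hL he hd
    (downBound_inf' hφ C.nonempty C.mem C.isCut he)
  exact ⟨C', h, r, h', h''⟩

/-- The symmetry `y ↦ -y` exchanges up and down, so this is `exists_down_le` for the mirrored cut.
-/
theorem exists_up_le' (C : FinCut W φ) {a b : V} (ha : a ∈ W) (hb : b ∈ C.dom) {c : L}
    (hbc : C.up b ≤ c) (hab : φ a ≤ C.down b ⊔ c) : ∃ C' : FinCut W φ, C ≤ C' ∧
      ∃ s : k, 0 < s ∧ b - s • a ∈ C'.dom ∧ C'.up (b - s • a) ≤ c := by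
  obtain ⟨C', h, s, hs, h1, h2⟩ := C.neg.exists_down_le hφ hcl hL ha (b := -b) (c := c)
    (mem_neg_dom.2 (by simpa using hb)) (by simpa [neg] using hbc) (by simpa [neg] using hab)
  have e : -(b - s • a) = -b + s • a := by abel
  exact ⟨C'.neg, le_neg_of_neg_le h, s, hs, mem_neg_dom.2 (e ▸ h1), by
    change C'.down (-(b - s • a)) ≤ c; rwa [e]⟩

theorem exists_down_le' (C : FinCut W φ) {q b : V} (hq : q ∈ W) (hb : b ∈ C.dom) {c : L}
    (hqc : φ (-q) ≤ c) (hbq : C.down b ≤ φ q ⊔ c) : ∃ C' : FinCut W φ, C ≤ C' ∧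
      ∃ r : k, b - r • q ∈ C'.dom ∧ C'.down (b - r • q) ≤ c := by
  obtain ⟨C', h, s, h1, h2⟩ := C.neg.exists_up_le hφ hcl hL hq (b := -b) (c := c)
    (mem_neg_dom.2 (by simpa using hb)) hqc (by simpa [neg] using hbq)
  have e : -(b - s • q) = -b + s • q := by abel
  exact ⟨C'.neg, le_neg_of_neg_le h, s, mem_neg_dom.2 (e ▸ h1), by
    change C'.up (-(b - s • q)) ≤ c; rwa [e]⟩

end FinCut

/-- A cut of all of `W` that keeps the closedness of `φ`. -/
structure IsClosedCut (W : Submodule k V) (φ U D : V → L) : Prop where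
  isCut : IsCut φ W U D
  down_bound : ∀ a ∈ W, ∀ b ∈ W, ∀ c, D b ≤ c → φ a ≤ U b ⊔ c →
    ∃ s : k, 0 < s ∧ D (b + s • a) ≤ c
  up_bound : ∀ a ∈ W, ∀ b ∈ W, ∀ c, U b ≤ c → φ a ≤ D b ⊔ c →
    ∃ s : k, 0 < s ∧ U (b - s • a) ≤ c
  up_bound' : ∀ q ∈ W, ∀ b ∈ W, ∀ c, φ (-q) ≤ c → U b ≤ φ q ⊔ c → ∃ r : k, U (b + r • q) ≤ c
  down_bound' : ∀ q ∈ W, ∀ b ∈ W, ∀ c, φ (-q) ≤ c → D b ≤ φ q ⊔ c → ∃ r : k, D (b - r • q) ≤ c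

theorem HasCountablyBasedDifferences.exists_basis (h : HasCountablyBasedDifferences L) :
    ∃ f : L → L → ℕ → L, ∀ a b x, a ≤ b ⊔ x ↔ ∃ n, f a b n ≤ x := by
  have : ∀ a b : L, ∃ f : ℕ → L, ∀ x, a ≤ b ⊔ x ↔ ∃ n, f n ≤ x := by
    intro a b
    obtain ⟨C, hC, hCx⟩ := h a b
    obtain ⟨c, hc, -⟩ := (hCx a).1 le_sup_right
    obtain ⟨f, rfl⟩ := hC.exists_eq_range ⟨c, hc⟩
    exact ⟨f, fun x => by simpa using hCx x⟩
  choose f hf using this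
  exact ⟨f, hf⟩

/-- A sufficiently generic ideal of finite cuts. Closedness quantifies over all `c : L`, but by
countably based differences it suffices to treat a countable base of values for each pair of
vectors. -/
theorem FinCut.exists_isClosedCut {W : Submodule k V} {φ : V → L} (hW : (W : Set V).Countable)
    (hφ : IsPositivityMap W φ) (hcl : IsClosedMap W φ) (hL : IsCompletelyNormal L)
    (hD : HasCountablyBasedDifferences L) (C₀ : FinCut W φ) :
    ∃ U D : V → L, IsClosedCut W φ U D ∧ ∀ a ∈ C₀.dom, U a = C₀.up a ∧ D a = C₀.down a := by
  obtain ⟨f, hf⟩ := hD.exists_basis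
  have hf' : ∀ a b n, a ≤ b ⊔ f a b n := fun a b n => (hf a b _).2 ⟨n, le_rfl⟩
  have : Countable W := hW
  let ι := W × W × ℕ
  let : Encodable (Fin 4 × ι) := Encodable.ofCountable _
  let P : Fin 4 → W → W → ℕ → FinCut W φ → Prop := fun j a b n C =>
    match j with
    | 0 => ∃ s : k, 0 < s ∧ b.1 + s • a.1 ∈ C.dom ∧
        C.down (b.1 + s • a.1) ≤ f (φ a) (C.up b) n ⊔ C.down b
    | 1 => ∃ s : k, 0 < s ∧ b.1 - s • a.1 ∈ C.dom ∧
        C.up (b.1 - s • a.1) ≤ f (φ a) (C.down b) n ⊔ C.up b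
    | 2 => ∃ r : k, b.1 + r • a.1 ∈ C.dom ∧
        C.up (b.1 + r • a.1) ≤ f (C.up b) (φ a) n ⊔ φ (-a)
    | 3 => ∃ r : k, b.1 - r • a.1 ∈ C.dom ∧
        C.down (b.1 - r • a.1) ≤ f (C.down b) (φ a) n ⊔ φ (-a)
  have hP : ∀ j a b n, IsCofinal {C : FinCut W φ | b.1 ∈ C.dom ∧ P j a b n C} := by
    intro j a b n C
    -- The target value depends on the cut at `b`, so that cut must be decided first; later
    -- extensions do not change it.
    obtain ⟨C₁, hC₁, hb⟩ := C.exists_mem_dom hφ hL b.2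
    match j with
    | 0 =>
      obtain ⟨C₂, h, s, hs, hm, hle⟩ := C₁.exists_down_le hφ hcl hL a.2 hb
        (c := f (φ a) (C₁.up b) n ⊔ C₁.down b) le_sup_right
        ((hf' _ _ n).trans (sup_le_sup_left le_sup_left _))
      refine ⟨C₂, ⟨h.1 hb, s, hs, hm, ?_⟩, hC₁.trans h⟩
      rwa [(h.2 b hb).1, (h.2 b hb).2]
    | 1 =>
      obtain ⟨C₂, h, s, hs, hm, hle⟩ := C₁.exists_up_le' hφ hcl hL a.2 hb
        (c := f (φ a) (C₁.down b) n ⊔ C₁.up b) le_sup_right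
        ((hf' _ _ n).trans (sup_le_sup_left le_sup_left _))
      refine ⟨C₂, ⟨h.1 hb, s, hs, hm, ?_⟩, hC₁.trans h⟩
      rwa [(h.2 b hb).1, (h.2 b hb).2]
    | 2 =>
      obtain ⟨C₂, h, s, hm, hle⟩ := C₁.exists_up_le hφ hcl hL a.2 hb
        (c := f (C₁.up b) (φ a) n ⊔ φ (-a)) le_sup_right
        ((hf' _ _ n).trans (sup_le_sup_left le_sup_left _))
      refine ⟨C₂, ⟨h.1 hb, s, hm, ?_⟩, hC₁.trans h⟩
      rwa [(h.2 b hb).1]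
    | 3 =>
      obtain ⟨C₂, h, s, hm, hle⟩ := C₁.exists_down_le' hφ hcl hL a.2 hb
        (c := f (C₁.down b) (φ a) n ⊔ φ (-a)) le_sup_right
        ((hf' _ _ n).trans (sup_le_sup_left le_sup_left _))
      refine ⟨C₂, ⟨h.1 hb, s, hm, ?_⟩, hC₁.trans h⟩
      rwa [(h.2 b hb).2]
  let 𝒟 : Fin 4 × ι → Order.Cofinal (FinCut W φ) := fun x => ⟨_, hP x.1 x.2.1 x.2.2.1 x.2.2.2⟩
  let I := Order.idealOfCofinals C₀ 𝒟
  have meet : ∀ j a b n, ∃ C ∈ I, b.1 ∈ C.dom ∧ P j a b n C := fun j a b n => by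
    obtain ⟨C, h, hI⟩ := Order.cofinal_meets_idealOfCofinals C₀ 𝒟 (j, a, b, n)
    exact ⟨C, hI, h⟩
  -- Every cofinal set also demands `b ∈ C.dom`, so any one of them shows that the generic cut is
  -- total.
  have hdom : ∀ b ∈ W, ∃ C ∈ I, b ∈ C.dom := fun b hb => by
    obtain ⟨C, hI, h, -⟩ := meet 0 ⟨b, hb⟩ ⟨b, hb⟩ 0
    exact ⟨C, hI, h⟩
  have : Nonempty (FinCut W φ) := ⟨C₀⟩
  choose! G hGI hGm using hdom
  have agree : ∀ C ∈ I, ∀ a ∈ C.dom, (G a).up a = C.up a ∧ (G a).down a = C.down a := by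
    intro C hC a ha
    have haW := C.mem a ha
    obtain ⟨C', -, h1, h2⟩ := I.directed _ (hGI a haW) _ hC
    exact ⟨(h1.2 a (hGm a haW)).1.symm.trans (h2.2 a ha).1,
      (h1.2 a (hGm a haW)).2.symm.trans (h2.2 a ha).2⟩
  have common : ∀ a ∈ W, ∀ b ∈ W, ∃ C ∈ I, a ∈ C.dom ∧ b ∈ C.dom := fun a ha b hb => by
    obtain ⟨C', h, h1, h2⟩ := I.directed _ (hGI a ha) _ (hGI b hb)
    exact ⟨C', h, h1.1 (hGm a ha), h2.1 (hGm b hb)⟩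
  refine ⟨fun a => (G a).up a, fun a => (G a).down a, ⟨⟨?_, ?_, ?_, ?_⟩, ?_, ?_, ?_, ?_⟩,
    agree C₀ (Order.mem_idealOfCofinals _ _)⟩
  · intro a ha
    exact (G a).isCut.inf_eq a (hGm a ha)
  · intro a ha b hb
    obtain ⟨C, hC, haC, hbC⟩ := common a ha b hb
    rw [(agree C hC a haC).1, (agree C hC b hbC).2]
    exact C.isCut.le_sup a haC b hbC
  · intro a ha b hb
    obtain ⟨C, hC, haC, hbC⟩ := common a ha b hb
    rw [(agree C hC a haC).1, (agree C hC b hbC).1]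
    exact C.isCut.up_le a haC b hbC
  · intro a ha b hb
    obtain ⟨C, hC, haC, hbC⟩ := common a ha b hb
    rw [(agree C hC a haC).2, (agree C hC b hbC).2]
    exact C.isCut.down_le a haC b hbC
  · intro a ha b hb c hbc hab
    obtain ⟨n, hn⟩ := (hf _ _ _).1 hab
    obtain ⟨C, hC, hbC, s, hs, hm, hle⟩ := meet 0 ⟨a, ha⟩ ⟨b, hb⟩ n
    refine ⟨s, hs, ?_⟩
    rw [(agree C hC _ hm).2]
    rw [(agree C hC b hbC).2] at hbc
    rw [(agree C hC b hbC).1] at hn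
    exact hle.trans (sup_le hn hbc)
  · intro a ha b hb c hbc hab
    obtain ⟨n, hn⟩ := (hf _ _ _).1 hab
    obtain ⟨C, hC, hbC, s, hs, hm, hle⟩ := meet 1 ⟨a, ha⟩ ⟨b, hb⟩ n
    refine ⟨s, hs, ?_⟩
    rw [(agree C hC _ hm).1]
    rw [(agree C hC b hbC).1] at hbc
    rw [(agree C hC b hbC).2] at hn
    exact hle.trans (sup_le hn hbc)
  · intro a ha b hb c hbc hab
    obtain ⟨n, hn⟩ := (hf _ _ _).1 hab
    obtain ⟨C, hC, hbC, s, hm, hle⟩ := meet 2 ⟨a, ha⟩ ⟨b, hb⟩ n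
    refine ⟨s, ?_⟩
    rw [(agree C hC _ hm).1]
    rw [(agree C hC b hbC).1] at hn
    exact hle.trans (sup_le hn hbc)
  · intro a ha b hb c hbc hab
    obtain ⟨n, hn⟩ := (hf _ _ _).1 hab
    obtain ⟨C, hC, hbC, s, hm, hle⟩ := meet 3 ⟨a, ha⟩ ⟨b, hb⟩ n
    refine ⟨s, ?_⟩
    rw [(agree C hC _ hm).2]
    rw [(agree C hC b hbC).2] at hn
    exact hle.trans (sup_le hn hbc)

end Generic

/-! ### Extending a positivity map along a cut -/

section OneStep

variable {k : Type*} [DivisionRing k] [LinearOrder k] [IsStrictOrderedRing k]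
  {V : Type*} [AddCommGroup V] [Module k V] {L : Type*} [DistribLattice L] [OrderBot L]

theorem IsPositivityMap.smul_le_sup {W : Submodule k V} {φ : V → L} (hφ : IsPositivityMap W φ)
    (r : k) {a : V} (ha : a ∈ W) : φ (r • a) ≤ φ a ⊔ φ (-a) := by
  rcases le_total 0 r with h | h
  · exact le_sup_of_le_left (hφ.smul_le h ha)
  · rw [← neg_smul_neg]
    exact le_sup_of_le_right (hφ.smul_le (neg_nonneg.2 h) (W.neg_mem ha))

open Classical in
/-- The extension of `φ` determined by a cut `(U, D)` for the new element `e`, where the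
coordinate `t` is `1` at `e` and vanishes on the domain of `φ`. -/
noncomputable def cutExtension (t : V →ₗ[k] k) (e : V) (φ U D : V → L) (x : V) : L :=
  if t x = 0 then φ x else if 0 < t x then U (e - (t x)⁻¹ • x) else D (e - (t x)⁻¹ • x)

variable {W W' : Submodule k V} {φ U D : V → L} {t : V →ₗ[k] k} {e : V}

theorem cutExtension_of_eq_zero {x : V} (h : t x = 0) : cutExtension t e φ U D x = φ x := by
  simp [cutExtension, h]

variable (hte : t e = 1) (hW : ∀ x ∈ W, t x = 0)
include hte hW

theorem cutExtension_smul_sub {r : k} (hr : 0 < r) {a : V} (ha : a ∈ W) :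
    cutExtension t e φ U D (r • (e - a)) = U a := by
  have h1 : t (r • (e - a)) = r := by simp [hte, hW a ha]
  rw [cutExtension, h1, if_neg hr.ne', if_pos hr, inv_smul_smul₀ hr.ne', sub_sub_cancel]

theorem cutExtension_smul_sub' {r : k} (hr : 0 < r) {a : V} (ha : a ∈ W) :
    cutExtension t e φ U D (r • (a - e)) = D a := by
  have h1 : t (r • (a - e)) = -r := by simp [hte, hW a ha]
  rw [cutExtension, h1, if_neg (neg_ne_zero.2 hr.ne'), if_neg (by simpa using hr.le), inv_neg,
    neg_smul, inv_smul_smul₀ hr.ne']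
  congr 1
  abel

omit hte hW in
theorem mem_or_exists_smul_sub (hW' : ∀ x ∈ W', x - t x • e ∈ W) {x : V} (hx : x ∈ W') :
    x ∈ W ∨ (∃ r : k, 0 < r ∧ ∃ a ∈ W, x = r • (e - a)) ∨
      ∃ r : k, 0 < r ∧ ∃ a ∈ W, x = r • (a - e) := by
  have h := hW' x hx
  rcases lt_trichotomy (t x) 0 with h0 | h0 | h0
  · refine Or.inr (Or.inr ⟨-t x, neg_pos.2 h0, -((t x)⁻¹ • (x - t x • e)),
      W.neg_mem (W.smul_mem _ h), ?_⟩)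
    rw [smul_sub, smul_neg, neg_smul, neg_neg, smul_inv_smul₀ h0.ne, neg_smul]
    abel
  · left
    simpa [h0] using h
  · refine Or.inr (Or.inl ⟨t x, h0, -((t x)⁻¹ • (x - t x • e)),
      W.neg_mem (W.smul_mem _ h), ?_⟩)
    rw [smul_sub, smul_neg, smul_inv_smul₀ h0.ne']
    abel

variable (hφ : IsPositivityMap W φ) (hcut : IsCut φ W U D)
include hφ hcut

-- As `c` lies between `a` and `b`, the vectors `a - c` and `c - b` are positively proportional.
-- Hence `φ (a - c)` is disjoint from `φ (b - c)`, and meeting the two bounds for `U c` removes both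
-- terms.
omit hte hW in
theorem IsCut.up_convex {r s : k} (hr : 0 < r) (hs : 0 < s) {a b c : V} (ha : a ∈ W)
    (hb : b ∈ W) (hc : c ∈ W) (h : (r + s) • c = r • a + s • b) : U c ≤ U a ⊔ U b := by
  have h1 := hcut.up_le c hc a ha
  have h2 := hcut.up_le c hc b hb
  have e1 : r • (a - c) = s • -(b - c) := by
    have : r • c + s • c = r • a + s • b := by rw [← add_smul, h]
    rw [smul_neg, smul_sub, smul_sub, sub_eq_iff_eq_add, neg_sub, sub_add_eq_add_sub,
      eq_sub_iff_add_eq, ← this, add_comm]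
  have e2 : φ (a - c) = φ (-(b - c)) := by
    rw [← hφ.smul r hr _ (W.sub_mem ha hc), e1, hφ.smul s hs _ (W.neg_mem (W.sub_mem hb hc))]
  have h3 := hφ.inf_neg _ (W.sub_mem hb hc)
  rw [← e2] at h3
  calc U c ≤ (U a ⊔ U b ⊔ φ (b - c)) ⊓ (U a ⊔ U b ⊔ φ (a - c)) :=
        le_inf (h2.trans (sup_le_sup_right le_sup_right _))
          (h1.trans (sup_le_sup_right le_sup_left _))
    _ = U a ⊔ U b := by rw [← sup_inf_left, h3, sup_bot_eq]

omit hte hW in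
theorem IsCut.down_convex {r s : k} (hr : 0 < r) (hs : 0 < s) {a b c : V} (ha : a ∈ W)
    (hb : b ∈ W) (hc : c ∈ W) (h : (r + s) • c = r • a + s • b) : D c ≤ D a ⊔ D b := by
  have hneg : IsCut φ W (fun a => D (-a)) (fun a => U (-a)) := by
    convert hcut.neg using 1
    ext a
    simp
  have := hneg.up_convex hφ hr hs (W.neg_mem ha) (W.neg_mem hb) (W.neg_mem hc)
    (by rw [smul_neg, h, smul_neg, smul_neg, neg_add])
  simpa using this

/-- The sign of `r - s` decides which side of the cut the sum falls on. Its cut point is `a` or `b`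
shifted along `b - a`, and `φ (b - a) ≤ U a ⊔ D b` absorbs the shift. -/
theorem cutExtension_add_le_of_up_down {r s : k} (hr : 0 < r) (hs : 0 < s) {a b : V} (ha : a ∈ W)
    (hb : b ∈ W) : cutExtension t e φ U D (r • (e - a) + s • (b - e)) ≤ U a ⊔ D b := by
  rcases lt_trichotomy r s with h | h | h
  · have h0 : 0 < s - r := sub_pos.2 h
    have hab := W.sub_mem hb ha
    have hc : b + (s - r)⁻¹ • r • (b - a) ∈ W := W.add_mem hb (W.smul_mem _ (W.smul_mem _ hab))
    have e1 : r • (e - a) + s • (b - e) = (s - r) • (b + (s - r)⁻¹ • r • (b - a) - e) := by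
      rw [smul_sub (s - r), smul_add, smul_inv_smul₀ h0.ne', sub_smul, sub_smul, smul_sub,
        smul_sub, smul_sub]
      abel
    rw [e1, cutExtension_smul_sub' hte hW h0 hc]
    refine (hcut.down_le _ hc b hb).trans (sup_le le_sup_right ?_)
    rw [add_sub_cancel_left, hφ.smul _ (inv_pos.2 h0) _ (W.smul_mem _ hab), hφ.smul _ hr _ hab]
    exact hcut.le_sup a ha b hb
  · subst h
    have hab := W.sub_mem hb ha
    rw [← smul_add, show e - a + (b - e) = b - a by abel,
      cutExtension_of_eq_zero (hW _ (W.smul_mem _ hab)), hφ.smul _ hr _ hab]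
    exact hcut.le_sup a ha b hb
  · have h0 : 0 < r - s := sub_pos.2 h
    have hab := W.sub_mem hb ha
    have hc : a - (r - s)⁻¹ • s • (b - a) ∈ W := W.sub_mem ha (W.smul_mem _ (W.smul_mem _ hab))
    have e1 : r • (e - a) + s • (b - e) = (r - s) • (e - (a - (r - s)⁻¹ • s • (b - a))) := by
      rw [smul_sub (r - s), smul_sub (r - s) a, smul_inv_smul₀ h0.ne', sub_smul, sub_smul,
        smul_sub, smul_sub, smul_sub]
      abel
    rw [e1, cutExtension_smul_sub hte hW h0 hc]
    refine (hcut.up_le _ hc a ha).trans (sup_le le_sup_left ?_)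
    rw [sub_sub_cancel, hφ.smul _ (inv_pos.2 h0) _ (W.smul_mem _ hab), hφ.smul _ hs _ hab]
    exact hcut.le_sup a ha b hb

theorem cutExtension_add_le_of_up_mem {r : k} (hr : 0 < r) {a w : V} (ha : a ∈ W)
    (hw : w ∈ W) : cutExtension t e φ U D (r • (e - a) + w) ≤ U a ⊔ φ w := by
  have hc : a - r⁻¹ • w ∈ W := W.sub_mem ha (W.smul_mem _ hw)
  have e1 : r • (e - a) + w = r • (e - (a - r⁻¹ • w)) := by
    rw [smul_sub, smul_sub, smul_sub, smul_inv_smul₀ hr.ne']; abel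
  rw [e1, cutExtension_smul_sub hte hW hr hc]
  refine (hcut.up_le _ hc a ha).trans (sup_le le_sup_left ?_)
  rw [sub_sub_cancel, hφ.smul _ (inv_pos.2 hr) _ hw]
  exact le_sup_right

theorem cutExtension_add_le_of_down_mem {r : k} (hr : 0 < r) {a w : V} (ha : a ∈ W)
    (hw : w ∈ W) : cutExtension t e φ U D (r • (a - e) + w) ≤ D a ⊔ φ w := by
  have hc : a + r⁻¹ • w ∈ W := W.add_mem ha (W.smul_mem _ hw)
  have e1 : r • (a - e) + w = r • (a + r⁻¹ • w - e) := by
    rw [smul_sub, smul_sub, smul_add, smul_inv_smul₀ hr.ne']; abel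
  rw [e1, cutExtension_smul_sub' hte hW hr hc]
  refine (hcut.down_le _ hc a ha).trans (sup_le le_sup_left ?_)
  rw [add_sub_cancel_left, hφ.smul _ (inv_pos.2 hr) _ hw]
  exact le_sup_right

theorem isPositivityMap_cutExtension (hW' : ∀ x ∈ W', x - t x • e ∈ W) :
    IsPositivityMap W' (cutExtension t e φ U D) where
  inf_neg x hx := by
    rcases mem_or_exists_smul_sub hW' hx with h | ⟨r, hr, a, ha, rfl⟩ | ⟨r, hr, a, ha, rfl⟩
    · rw [cutExtension_of_eq_zero (hW x h), cutExtension_of_eq_zero (hW _ (W.neg_mem h)),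
        hφ.inf_neg x h]
    · rw [← smul_neg, neg_sub, cutExtension_smul_sub hte hW hr ha,
        cutExtension_smul_sub' hte hW hr ha, hcut.inf_eq a ha]
    · rw [← smul_neg, neg_sub, cutExtension_smul_sub hte hW hr ha,
        cutExtension_smul_sub' hte hW hr ha, inf_comm, hcut.inf_eq a ha]
  smul s hs x hx := by
    rcases mem_or_exists_smul_sub hW' hx with h | ⟨r, hr, a, ha, rfl⟩ | ⟨r, hr, a, ha, rfl⟩
    · rw [cutExtension_of_eq_zero (hW x h), cutExtension_of_eq_zero (hW _ (W.smul_mem _ h)),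
        hφ.smul s hs x h]
    · rw [← mul_smul, cutExtension_smul_sub hte hW hr ha,
        cutExtension_smul_sub hte hW (mul_pos hs hr) ha]
    · rw [← mul_smul, cutExtension_smul_sub' hte hW hr ha,
        cutExtension_smul_sub' hte hW (mul_pos hs hr) ha]
  add_le x hx y hy := by
    rcases mem_or_exists_smul_sub hW' hx with h | ⟨r, hr, a, ha, rfl⟩ | ⟨r, hr, a, ha, rfl⟩ <;>
    rcases mem_or_exists_smul_sub hW' hy with h' | ⟨s, hs, b, hb, rfl⟩ | ⟨s, hs, b, hb, rfl⟩
    · rw [cutExtension_of_eq_zero (hW _ h), cutExtension_of_eq_zero (hW _ h'),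
        cutExtension_of_eq_zero (hW _ (W.add_mem h h'))]
      exact hφ.add_le _ h _ h'
    · rw [add_comm, sup_comm, cutExtension_of_eq_zero (hW _ h), cutExtension_smul_sub hte hW hs hb]
      exact cutExtension_add_le_of_up_mem hte hW hφ hcut hs hb h
    · rw [add_comm, sup_comm, cutExtension_of_eq_zero (hW _ h), cutExtension_smul_sub' hte hW hs hb]
      exact cutExtension_add_le_of_down_mem hte hW hφ hcut hs hb h
    · rw [cutExtension_of_eq_zero (hW _ h'), cutExtension_smul_sub hte hW hr ha]
      exact cutExtension_add_le_of_up_mem hte hW hφ hcut hr ha h'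
    · have h0 : 0 < r + s := add_pos hr hs
      have hc : (r + s)⁻¹ • (r • a + s • b) ∈ W :=
        W.smul_mem _ (W.add_mem (W.smul_mem _ ha) (W.smul_mem _ hb))
      have e1 : r • (e - a) + s • (e - b) = (r + s) • (e - (r + s)⁻¹ • (r • a + s • b)) := by
        rw [smul_sub (r + s), smul_inv_smul₀ h0.ne', smul_sub, smul_sub, add_smul]; abel
      rw [e1, cutExtension_smul_sub hte hW h0 hc, cutExtension_smul_sub hte hW hr ha,
        cutExtension_smul_sub hte hW hs hb]
      exact hcut.up_convex hφ hr hs ha hb hc (smul_inv_smul₀ h0.ne' _)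
    · rw [cutExtension_smul_sub hte hW hr ha, cutExtension_smul_sub' hte hW hs hb]
      exact cutExtension_add_le_of_up_down hte hW hφ hcut hr hs ha hb
    · rw [cutExtension_of_eq_zero (hW _ h'), cutExtension_smul_sub' hte hW hr ha]
      exact cutExtension_add_le_of_down_mem hte hW hφ hcut hr ha h'
    · rw [add_comm, sup_comm, cutExtension_smul_sub' hte hW hr ha,
        cutExtension_smul_sub hte hW hs hb]
      exact cutExtension_add_le_of_up_down hte hW hφ hcut hs hr hb ha
    · have h0 : 0 < r + s := add_pos hr hs
      have hc : (r + s)⁻¹ • (r • a + s • b) ∈ W :=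
        W.smul_mem _ (W.add_mem (W.smul_mem _ ha) (W.smul_mem _ hb))
      have e1 : r • (a - e) + s • (b - e) = (r + s) • ((r + s)⁻¹ • (r • a + s • b) - e) := by
        rw [smul_sub (r + s), smul_inv_smul₀ h0.ne', smul_sub, smul_sub, add_smul]; abel
      rw [e1, cutExtension_smul_sub' hte hW h0 hc, cutExtension_smul_sub' hte hW hr ha,
        cutExtension_smul_sub' hte hW hs hb]
      exact hcut.down_convex hφ hr hs ha hb hc (smul_inv_smul₀ h0.ne' _)

-- When `q ∈ W` the primed bounds of `hUD` apply. Otherwise subtracting a multiple of `q` from `p`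
-- eliminates the coordinate of `e`, and the unprimed bounds apply.
omit hcut in
theorem isClosedMap_cutExtension (hW' : ∀ x ∈ W', x - t x • e ∈ W)
    (hcl : IsClosedMap W φ) (hUD : IsClosedCut W φ U D) :
    IsClosedMap W' (cutExtension t e φ U D) := by
  have hψ := isPositivityMap_cutExtension hte hW hφ hUD.isCut hW'
  have mem : ∀ x ∈ W', t x = 0 → x ∈ W := fun x hx h0 => by simpa [h0] using hW' x hx
  intro p hp q hq c hqc hpq
  rcases mem_or_exists_smul_sub hW' hq with h | ⟨m, hm, b, hb, rfl⟩ | ⟨m, hm, b, hb, rfl⟩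
  · rw [cutExtension_of_eq_zero (hW _ (W.neg_mem h))] at hqc
    rw [cutExtension_of_eq_zero (hW _ h)] at hpq
    rcases mem_or_exists_smul_sub hW' hp with h' | ⟨r, hr, a, ha, rfl⟩ | ⟨r, hr, a, ha, rfl⟩
    · rw [cutExtension_of_eq_zero (hW _ h')] at hpq
      obtain ⟨r, hr⟩ := hcl p h' q h c hqc hpq
      refine ⟨r, ?_⟩
      rwa [cutExtension_of_eq_zero (hW _ (W.sub_mem h' (W.smul_mem _ h)))]
    · rw [cutExtension_smul_sub hte hW hr ha] at hpq
      obtain ⟨s, hs⟩ := hUD.up_bound' q h a ha c hqc hpq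
      refine ⟨r * s, ?_⟩
      rwa [mul_smul, ← smul_sub, sub_sub,
        cutExtension_smul_sub hte hW hr (W.add_mem ha (W.smul_mem _ h))]
    · rw [cutExtension_smul_sub' hte hW hr ha] at hpq
      obtain ⟨s, hs⟩ := hUD.down_bound' q h a ha c hqc hpq
      refine ⟨r * s, ?_⟩
      rwa [mul_smul, ← smul_sub, sub_right_comm,
        cutExtension_smul_sub' hte hW hr (W.sub_mem ha (W.smul_mem _ h))]
  · set q := m • (e - b) with hqdef
    set p' := p - (t p * m⁻¹) • q with hp'
    have hp'W' : p' ∈ W' := W'.sub_mem hp (W'.smul_mem _ hq)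
    have htp' : t p' = 0 := by
      simp [hp', hqdef, hte, hW b hb, mul_assoc, inv_mul_cancel₀ hm.ne']
    have hp'W := mem p' hp'W' htp'
    -- A multiple of `q` of either sign costs at most the values at `q` and `-q`, and the latter is
    -- below `c`.
    have h1 : cutExtension t e φ U D p' ≤ cutExtension t e φ U D q ⊔ c := by
      rw [hp', sub_eq_add_neg, ← neg_smul]
      refine (hψ.add_le _ hp _ (W'.smul_mem _ hq)).trans (sup_le hpq ?_)
      exact (hψ.smul_le_sup _ hq).trans (sup_le_sup_left hqc _)
    rw [← smul_neg, neg_sub, cutExtension_smul_sub' hte hW hm hb] at hqc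
    rw [cutExtension_of_eq_zero htp', cutExtension_smul_sub hte hW hm hb] at h1
    obtain ⟨s, hs, hle⟩ := hUD.down_bound p' hp'W b hb c hqc h1
    -- The first summand turns `p` into `p'`; the second turns `p'` into `s⁻¹ • (b + s • p' - e)`.
    refine ⟨t p * m⁻¹ + s⁻¹ * m⁻¹, ?_⟩
    have e1 : p - (t p * m⁻¹ + s⁻¹ * m⁻¹) • q = s⁻¹ • (b + s • p' - e) := by
      rw [add_smul, ← sub_sub, ← hp', hqdef, mul_smul, inv_smul_smul₀ hm.ne']
      simp only [smul_sub, smul_add, inv_smul_smul₀ hs.ne']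
      abel
    rwa [e1, cutExtension_smul_sub' hte hW (inv_pos.2 hs) (W.add_mem hb (W.smul_mem _ hp'W))]
  · set q := m • (b - e) with hqdef
    set p' := p - (-(t p * m⁻¹)) • q with hp'
    have hp'W' : p' ∈ W' := W'.sub_mem hp (W'.smul_mem _ hq)
    have htp' : t p' = 0 := by
      simp [hp', hqdef, hte, hW b hb, mul_assoc, inv_mul_cancel₀ hm.ne']
    have hp'W := mem p' hp'W' htp'
    have h1 : cutExtension t e φ U D p' ≤ cutExtension t e φ U D q ⊔ c := by
      rw [hp', sub_eq_add_neg, ← neg_smul]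
      refine (hψ.add_le _ hp _ (W'.smul_mem _ hq)).trans (sup_le hpq ?_)
      exact (hψ.smul_le_sup _ hq).trans (sup_le_sup_left hqc _)
    rw [← smul_neg, neg_sub, cutExtension_smul_sub hte hW hm hb] at hqc
    rw [cutExtension_of_eq_zero htp', cutExtension_smul_sub' hte hW hm hb] at h1
    obtain ⟨s, hs, hle⟩ := hUD.up_bound p' hp'W b hb c hqc h1
    refine ⟨-(t p * m⁻¹) + s⁻¹ * m⁻¹, ?_⟩
    have e1 : p - (-(t p * m⁻¹) + s⁻¹ * m⁻¹) • q = s⁻¹ • (e - (b - s • p')) := by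
      rw [add_smul, ← sub_sub, ← hp', hqdef, mul_smul, inv_smul_smul₀ hm.ne']
      simp only [smul_sub, inv_smul_smul₀ hs.ne']
      abel
    rwa [e1, cutExtension_smul_sub hte hW (inv_pos.2 hs) (W.sub_mem hb (W.smul_mem _ hp'W))]

end OneStep

/-! ### Transfinite construction on the free vector space -/

section Transfinite

variable {k : Type*} [DivisionRing k] [LinearOrder k] [IsStrictOrderedRing k]
  {L : Type*} [DistribLattice L] [OrderBot L]

section Congr

variable {V : Type*} [AddCommGroup V] [Module k V] {W : Submodule k V} {φ ψ : V → L}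

theorem IsPositivityMap.congr (h : IsPositivityMap W φ) (e : ∀ a ∈ W, ψ a = φ a) :
    IsPositivityMap W ψ where
  inf_neg a ha := by rw [e a ha, e _ (W.neg_mem ha), h.inf_neg a ha]
  smul r hr a ha := by rw [e a ha, e _ (W.smul_mem r ha), h.smul r hr a ha]
  add_le a ha b hb := by
    rw [e a ha, e b hb, e _ (W.add_mem ha hb)]; exact h.add_le a ha b hb

theorem IsClosedMap.congr (h : IsClosedMap W φ) (e : ∀ a ∈ W, ψ a = φ a) :
    IsClosedMap W ψ := by
  intro p hp q hq c hqc hpq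
  rw [e _ (W.neg_mem hq)] at hqc
  rw [e _ hp, e _ hq] at hpq
  obtain ⟨r, hr⟩ := h p hp q hq c hqc hpq
  exact ⟨r, by rwa [e _ (W.sub_mem hp (W.smul_mem r hq))]⟩

/-- The cut of the positive part of `p`. -/
theorem IsPositivityMap.isCut_posPart (hφ : IsPositivityMap W φ) {p : V} (hp : p ∈ W) :
    IsCut φ W (fun a => φ (p - a) ⊔ φ (-a)) (fun a => φ (a - p) ⊓ φ a) where
  inf_eq a ha := by
    have h1 := hφ.inf_neg _ (W.sub_mem hp ha)
    have h2 := hφ.inf_neg _ ha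
    rw [neg_sub] at h1
    rw [eq_bot_iff, inf_sup_right]
    refine sup_le ?_ ?_
    · rw [← h1]; exact inf_le_inf_left _ inf_le_left
    · rw [← h2, inf_comm]; exact inf_le_inf_right _ inf_le_right
  le_sup a ha b hb := by
    rw [sup_inf_left]
    refine le_inf ?_ ?_
    · refine (hφ.le_of_eq_add (W.sub_mem hp ha) (W.sub_mem hb hp) (by abel)).trans ?_
      exact sup_le_sup_right le_sup_left _
    · refine (hφ.le_of_eq_add (W.neg_mem ha) hb (by abel)).trans ?_
      exact sup_le_sup_right le_sup_right _
  up_le a ha b hb := by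
    refine sup_le ?_ ?_
    · refine (hφ.le_of_eq_add (W.sub_mem hp hb) (W.sub_mem hb ha) (by abel)).trans ?_
      exact sup_le_sup_right le_sup_left _
    · refine (hφ.le_of_eq_add (W.neg_mem hb) (W.sub_mem hb ha) (by abel)).trans ?_
      exact sup_le_sup_right le_sup_right _
  down_le a ha b hb := by
    rw [sup_inf_right]
    refine inf_le_inf ?_ ?_
    · exact hφ.le_of_eq_add (W.sub_mem hb hp) (W.sub_mem ha hb) (by abel)
    · exact hφ.le_of_eq_add hb (W.sub_mem ha hb) (by abel)

theorem IsCut.mono {S S' : Set V} {U D : V → L} (h : IsCut φ S U D) (hS : S' ⊆ S) :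
    IsCut φ S' U D where
  inf_eq a ha := h.inf_eq a (hS ha)
  le_sup a ha b hb := h.le_sup a (hS ha) b (hS hb)
  up_le a ha b hb := h.up_le a (hS ha) b (hS hb)
  down_le a ha b hb := h.down_le a (hS ha) b (hS hb)

end Congr

variable {I : Type*} [LinearOrder I]

/-- `φ` carries out the task `τ` at the basis vector `i`: either its value there is prescribed, or
that basis vector is the positive part of a given vector of smaller support. -/
def Fulfills (τ : L ⊕ (I →₀ k)) (i : I) (φ : (I →₀ k) → L) : Prop :=
  φ (-Finsupp.single i 1) = ⊥ ∧
  (∀ c, τ = Sum.inl c → φ (Finsupp.single i 1) = c) ∧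
  ∀ p, τ = Sum.inr p → p ∈ Finsupp.supported k k (Set.Iio i) →
    φ (Finsupp.single i 1) = φ p ∧ φ (Finsupp.single i 1 - p) = φ (-p) ∧
      φ (p - Finsupp.single i 1) = ⊥

theorem single_mem_supported {J : Set I} {i : I} (hi : i ∈ J) :
    (Finsupp.single i 1 : I →₀ k) ∈ Finsupp.supported k k J :=
  Finsupp.single_mem_supported k 1 hi

theorem Fulfills.congr {τ : L ⊕ (I →₀ k)} {i : I} {φ ψ : (I →₀ k) → L} {J : Set I}
    (h : Fulfills τ i φ) (hi : i ∈ J) (hJ : IsLowerSet J)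
    (e : ∀ a ∈ Finsupp.supported k k J, ψ a = φ a) : Fulfills τ i ψ := by
  have hs : Finsupp.single i 1 ∈ Finsupp.supported k k J := single_mem_supported hi
  refine ⟨?_, fun c hc => ?_, fun p hp hpi => ?_⟩
  · rw [e _ (Submodule.neg_mem _ hs), h.1]
  · rw [e _ hs, h.2.1 c hc]
  · have hpJ : p ∈ Finsupp.supported k k J :=
      Finsupp.supported_mono (fun j hj => hJ (le_of_lt hj) hi) hpi
    have := h.2.2 p hp hpi
    rwa [e _ hs, e _ hpJ, e _ (Submodule.sub_mem _ hs hpJ), e _ (Submodule.neg_mem _ hpJ),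
      e _ (Submodule.sub_mem _ hpJ hs)]

/-- A task constrains the new vector only at `0` and `p`, so it can be encoded in a finite initial
cut, which the generic cut then extends. -/
theorem exists_finCut {W : Submodule k (I →₀ k)} {φ : (I →₀ k) → L} (hφ : IsPositivityMap W φ)
    (τ : L ⊕ (I →₀ k)) : ∃ C : FinCut W φ, 0 ∈ C.dom ∧ C.down 0 = ⊥ ∧
      (∀ c, τ = Sum.inl c → C.up 0 = c) ∧
      ∀ p, τ = Sum.inr p → p ∈ W → C.up 0 = φ p ∧ p ∈ C.dom ∧ C.up p = φ (-p) ∧ C.down p = ⊥ := by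
  classical
  have triv : ∀ c : L, ∃ C : FinCut W φ, 0 ∈ C.dom ∧ C.down 0 = ⊥ ∧ C.up 0 = c := fun c =>
    ⟨⟨{0}, by simp, by simp, fun _ => c, fun _ => ⊥,
      ⟨by simp, by simp [hφ.map_zero], by simp, by simp⟩⟩, by simp, rfl, rfl⟩
  rcases τ with c | p
  · obtain ⟨C, h1, h2, h3⟩ := triv c
    exact ⟨C, h1, h2, by rintro _ ⟨⟩; exact h3, by rintro _ ⟨⟩⟩
  · by_cases hp : p ∈ W
    · have hsub : ∀ a ∈ ({0, p} : Finset (I →₀ k)), a ∈ W := by simp [hp, W.zero_mem]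
      refine ⟨⟨{0, p}, by simp, hsub, _, _, (hφ.isCut_posPart hp).mono hsub⟩, by simp, ?_,
        by rintro _ ⟨⟩, ?_⟩
      · simp [hφ.map_zero]
      · rintro _ ⟨⟩ -
        simp [hφ.map_zero]
    · obtain ⟨C, h1, h2, -⟩ := triv ⊥
      exact ⟨C, h1, h2, by rintro _ ⟨⟩, by rintro _ ⟨⟩ h; exact absurd h hp⟩

theorem exists_step (hL : IsCompletelyNormal L) (hD : HasCountablyBasedDifferences L)
    (τ : L ⊕ (I →₀ k)) (i : I) {φ : (I →₀ k) → L}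
    (hW : (Finsupp.supported k k (Set.Iio i) : Set (I →₀ k)).Countable)
    (hφ : IsPositivityMap (Finsupp.supported k k (Set.Iio i)) φ)
    (hcl : IsClosedMap (Finsupp.supported k k (Set.Iio i)) φ) :
    ∃ ψ : (I →₀ k) → L, IsPositivityMap (Finsupp.supported k k (Set.Iic i)) ψ ∧
      IsClosedMap (Finsupp.supported k k (Set.Iic i)) ψ ∧
      (∀ a ∈ Finsupp.supported k k (Set.Iio i), ψ a = φ a) ∧ Fulfills τ i ψ := by
  obtain ⟨C, h0, hd0, hin, hinr⟩ := exists_finCut hφ τ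
  obtain ⟨U, D, hUD, hC⟩ := C.exists_isClosedCut hW hφ hcl hL hD
  let t : (I →₀ k) →ₗ[k] k := Finsupp.lapply i
  let e : I →₀ k := Finsupp.single i 1
  have hte : t e = 1 := by simp [t, e]
  have htW : ∀ x ∈ Finsupp.supported k k (Set.Iio i), t x = 0 := by
    intro x hx
    by_contra hne
    have : i ∈ x.support := by simpa [t] using hne
    exact lt_irrefl i ((Finsupp.mem_supported k x).1 hx this)
  have hW' : ∀ x ∈ Finsupp.supported k k (Set.Iic i),
      x - t x • e ∈ Finsupp.supported k k (Set.Iio i) := by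
    intro x hx
    rw [Finsupp.mem_supported]
    intro j hj
    have hj' : (x - t x • e) j ≠ 0 := by simpa using hj
    by_cases hji : j = i
    · subst hji; simp [t, e] at hj'
    · refine lt_of_le_of_ne ((Finsupp.mem_supported k x).1 hx ?_) hji
      simpa [e, Finsupp.single_apply, Ne.symm hji] using hj'
  have hval : ∀ a ∈ Finsupp.supported k k (Set.Iio i),
      cutExtension t e φ U D (e - a) = U a ∧ cutExtension t e φ U D (a - e) = D a := fun a ha => by
    constructor
    · simpa using cutExtension_smul_sub (φ := φ) (U := U) (D := D) hte htW one_pos ha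
    · simpa using cutExtension_smul_sub' (φ := φ) (U := U) (D := D) hte htW one_pos ha
  have hold : ∀ a ∈ Finsupp.supported k k (Set.Iio i), cutExtension t e φ U D a = φ a :=
    fun a ha => cutExtension_of_eq_zero (htW a ha)
  have hv0 := hval 0 (Submodule.zero_mem _)
  rw [sub_zero, zero_sub, (hC 0 h0).1, (hC 0 h0).2, hd0] at hv0
  refine ⟨cutExtension t e φ U D, isPositivityMap_cutExtension hte htW hφ hUD.isCut hW',
    isClosedMap_cutExtension hte htW hφ hW' hcl hUD, hold, hv0.2, fun c hc => ?_,
    fun p hp hpW => ?_⟩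
  · rw [← hin c hc]; exact hv0.1
  · obtain ⟨h1, h2, h3, h4⟩ := hinr p hp hpW
    have hvp := hval p hpW
    rw [(hC p h2).1, (hC p h2).2, h3, h4] at hvp
    rw [hold p hpW, hold _ (Submodule.neg_mem _ hpW), ← h1]
    exact ⟨hv0.1, hvp⟩

/-- Solutions of the extension problem on the span of a lower set of basis vectors. -/
structure PartialSolution (T : I → L ⊕ (I →₀ k)) where
  carrier : Set I
  lower : IsLowerSet carrier
  toFun : (I →₀ k) → L
  pos : IsPositivityMap (Finsupp.supported k k carrier) toFun
  closed : IsClosedMap (Finsupp.supported k k carrier) toFun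
  fulfills : ∀ i ∈ carrier, Fulfills (T i) i toFun

instance (T : I → L ⊕ (I →₀ k)) : Preorder (PartialSolution T) where
  le A B := A.carrier ⊆ B.carrier ∧ ∀ a ∈ Finsupp.supported k k A.carrier, B.toFun a = A.toFun a
  le_refl A := ⟨subset_rfl, fun _ _ => rfl⟩
  le_trans A B C h h' := ⟨h.1.trans h'.1, fun a ha =>
    (h'.2 a (Finsupp.supported_mono h.1 ha)).trans (h.2 a ha)⟩

/-- Each instance of positivity, closedness or a task involves finitely many vectors, hence already
lives in one member of the chain. -/
theorem PartialSolution.bddAbove {T : I → L ⊕ (I →₀ k)} {c : Set (PartialSolution T)}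
    (hc : IsChain (· ≤ ·) c) (hne : c.Nonempty) : BddAbove c := by
  classical
  have : Nonempty c := hne.to_subtype
  have hdir : Directed (· ⊆ ·) fun A : c => A.1.carrier := fun A B => by
    rcases hc.total A.2 B.2 with h | h
    · exact ⟨B, h.1, subset_rfl⟩
    · exact ⟨A, subset_rfl, h.1⟩
  let J : Set I := ⋃ A : c, A.1.carrier
  have hcover : ∀ s : Finset I, (s : Set I) ⊆ J → ∃ A : c, (s : Set I) ⊆ A.1.carrier :=
    fun s hs => hdir.exists_mem_subset_of_finset_subset_biUnion hs
  have hsup : ∀ a ∈ Finsupp.supported k k J, ∃ A ∈ c, a ∈ Finsupp.supported k k A.carrier :=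
    fun a ha => by
      obtain ⟨A, hA⟩ := hcover a.support ((Finsupp.mem_supported k a).1 ha)
      exact ⟨A.1, A.2, (Finsupp.mem_supported k a).2 hA⟩
  have hsup2 : ∀ a ∈ Finsupp.supported k k J, ∀ b ∈ Finsupp.supported k k J, ∃ A ∈ c,
      a ∈ Finsupp.supported k k A.carrier ∧ b ∈ Finsupp.supported k k A.carrier := by
    intro a ha b hb
    obtain ⟨A, hA, haA⟩ := hsup a ha
    obtain ⟨B, hB, hbB⟩ := hsup b hb
    rcases hc.total hA hB with h | h
    · exact ⟨B, hB, Finsupp.supported_mono h.1 haA, hbB⟩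
    · exact ⟨A, hA, haA, Finsupp.supported_mono h.1 hbB⟩
  have : Nonempty (PartialSolution T) := hne.to_type
  choose! G hG hGmem using hsup
  let φ : (I →₀ k) → L := fun a => (G a).toFun a
  have hle : ∀ A ∈ c, A.carrier ⊆ J := fun A hA => Set.subset_iUnion_of_subset ⟨A, hA⟩ subset_rfl
  have agree : ∀ A ∈ c, ∀ a ∈ Finsupp.supported k k A.carrier, φ a = A.toFun a := by
    intro A hA a ha
    have haJ := Finsupp.supported_mono (M := k) (R := k) (hle A hA) ha
    rcases hc.total hA (hG a haJ) with h | h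
    · exact h.2 a ha
    · exact (h.2 a (hGmem a haJ)).symm
  refine ⟨⟨J, isLowerSet_iUnion fun A => A.1.lower, φ, ⟨?_, ?_, ?_⟩, ?_, ?_⟩,
    fun A hA => ⟨hle A hA, agree A hA⟩⟩
  · intro a ha
    obtain ⟨A, hA, haA, -⟩ := hsup2 a ha a ha
    exact (A.pos.congr (agree A hA)).inf_neg a haA
  · intro r hr a ha
    obtain ⟨A, hA, haA, -⟩ := hsup2 a ha a ha
    exact (A.pos.congr (agree A hA)).smul r hr a haA
  · intro a ha b hb
    obtain ⟨A, hA, haA, hbA⟩ := hsup2 a ha b hb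
    exact (A.pos.congr (agree A hA)).add_le a haA b hbA
  · intro a ha b hb
    obtain ⟨A, hA, haA, hbA⟩ := hsup2 a ha b hb
    exact (A.closed.congr (agree A hA)) a haA b hbA
  · intro i hi
    obtain ⟨A, hA⟩ := Set.mem_iUnion.1 hi
    exact (A.1.fulfills i hA).congr hA A.1.lower (agree A.1 A.2)

/-- A maximal partial solution whose carrier is not everything has carrier `Iio i`, with `i` the
least missing index. Its span is countable, so `exists_step` applies and contradicts maximality. -/
theorem exists_positivityMap [WellFoundedLT I] [Countable k]
    (hI : ∀ i : I, (Set.Iio i).Countable) (hL : IsCompletelyNormal L)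
    (hD : HasCountablyBasedDifferences L) (T : I → L ⊕ (I →₀ k)) :
    ∃ φ : (I →₀ k) → L, IsPositivityMap (k := k) ⊤ φ ∧ IsClosedMap (k := k) ⊤ φ ∧
      ∀ i, Fulfills (T i) i φ := by
  let A₀ : PartialSolution T := ⟨∅, isLowerSet_empty, fun _ => ⊥,
    ⟨by simp, by simp, by simp⟩, by intro; simp, by simp⟩
  obtain ⟨A, hA⟩ := zorn_le (α := PartialSolution T) fun c hc => by
    rcases c.eq_empty_or_nonempty with rfl | hne
    · exact ⟨A₀, by simp⟩
    · exact PartialSolution.bddAbove hc hne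
  have huniv : A.carrier = Set.univ := by
    by_contra hne
    obtain ⟨i, hi, hmin⟩ := WellFounded.has_min (wellFounded_lt (α := I)) A.carrierᶜ
      (Set.nonempty_compl.2 hne)
    have hAi : A.carrier = Set.Iio i := by
      ext j
      constructor
      · intro hj
        exact lt_of_not_ge fun hij => hi (A.lower hij hj)
      · intro hj
        by_contra hj'
        exact hmin j hj' hj
    have hpos := A.pos
    have hcl := A.closed
    rw [hAi] at hpos hcl
    have hW : (Finsupp.supported k k (Set.Iio i) : Set (I →₀ k)).Countable := by
      have := (hI i).to_subtype
      exact (Finsupp.supportedEquivFinsupp (M := k) (R := k) (Set.Iio i)).injective.countable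
    obtain ⟨ψ, h1, h2, h3, h4⟩ := exists_step hL hD (T i) i hW hpos hcl
    let B : PartialSolution T := ⟨Set.Iic i, isLowerSet_Iic i, ψ, h1, h2, fun j hj => by
      rcases (Set.mem_Iic.1 hj).eq_or_lt with rfl | hlt
      · exact h4
      · exact (A.fulfills j (hAi ▸ hlt)).congr (J := Set.Iio i) hlt (isLowerSet_Iio i) h3⟩
    have hAB : A ≤ B := by
      refine ⟨?_, ?_⟩
      · rw [hAi]; exact Set.Iio_subset_Iic_self
      · rw [hAi]; exact h3
    exact hi ((hA hAB).1 (Set.mem_Iic.2 le_rfl))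
  have hpos := A.pos
  have hcl := A.closed
  rw [huniv, Finsupp.supported_univ] at hpos hcl
  exact ⟨A.toFun, hpos, hcl, fun i => A.fulfills i (huniv ▸ Set.mem_univ i)⟩

end Transfinite

/-! ### Isomorphisms with `Id_c`, and the necessity of both conditions -/

section IdcMaps

variable {L : Type*} [DistribLattice L] [OrderBot L]

/-- `ψ` induces an isomorphism from `Id_c E` onto `L`, sending `⟨a⟩` to `ψ a` for `0 ≤ a`. -/
def IsIdcMap (R : Type*) {E : Type*} [Ring R] [LinearOrder R] [AddCommGroup E] [Lattice E]
    [Module R E] (ψ : E → L) : Prop :=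
  (∀ c, ∃ a, 0 ≤ a ∧ ψ a = c) ∧
    ∀ a b, 0 ≤ a → 0 ≤ b → (ψ a ≤ ψ b ↔ ∃ r : R, 0 ≤ r ∧ a ≤ r • b)

variable {R : Type*} {E : Type*} [Ring R] [LinearOrder R] [IsStrictOrderedRing R]
  [AddCommGroup E] [Lattice E] [Module R E] [PosSMulMono R E] [IsOrderedAddMonoid E]

theorem principalLIdeal_le_iff {a b : E} (ha : 0 ≤ a) (hb : 0 ≤ b) :
    principalLIdeal R a ≤ principalLIdeal R b ↔ ∃ r : R, 0 ≤ r ∧ a ≤ r • b := by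
  constructor
  · intro h
    have : a ∈ principalLIdeal R b := h ⟨1, zero_le_one, by simp⟩
    obtain ⟨r, hr, hab⟩ := this
    rw [abs_of_nonneg ha, abs_of_nonneg hb] at hab
    exact ⟨r, hr, hab⟩
  · rintro ⟨r, hr, hab⟩ x ⟨s, hs, hx⟩
    refine ⟨s * r, mul_nonneg hs hr, hx.trans ?_⟩
    rw [abs_of_nonneg ha, abs_of_nonneg hb, mul_smul]
    exact smul_le_smul_of_nonneg_left hab hs

theorem IsIdcMap.nonempty_orderIso {ψ : E → L} (h : IsIdcMap R ψ) : Nonempty (L ≃o Idc R E) := by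
  choose g hg hψ using h.1
  let f : L → Idc R E := fun c => ⟨principalLIdeal R (g c), g c, hg c, rfl⟩
  have hf : ∀ c d, f c ≤ f d ↔ c ≤ d := fun c d => by
    rw [← Subtype.coe_le_coe, principalLIdeal_le_iff (hg c) (hg d), ← h.2 _ _ (hg c) (hg d),
      hψ, hψ]
  refine ⟨RelIso.ofSurjective (OrderEmbedding.ofMapLEIff f hf) ?_⟩
  rintro ⟨_, a, ha, rfl⟩
  refine ⟨ψ a, Subtype.ext (le_antisymm ?_ ?_)⟩
  · exact (principalLIdeal_le_iff (hg _) ha).2 ((h.2 _ _ (hg _) ha).1 (hψ _).le)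
  · exact (principalLIdeal_le_iff ha (hg _)).2 ((h.2 _ _ ha (hg _)).1 (hψ _).ge)

theorem exists_isIdcMap (e : L ≃o Idc R E) : ∃ ψ : E → L, IsIdcMap R ψ := by
  refine ⟨fun a => e.symm ⟨principalLIdeal R |a|, |a|, abs_nonneg a, rfl⟩, fun c => ?_,
    fun a b ha hb => ?_⟩
  · obtain ⟨a, ha, h⟩ := (e c).2
    refine ⟨a, ha, e.symm_apply_eq.2 (Subtype.ext ?_)⟩
    exact (congrArg (principalLIdeal R) (abs_of_nonneg ha)).trans h.symm
  · rw [e.symm.le_iff_le, ← Subtype.coe_le_coe,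
      principalLIdeal_le_iff (abs_nonneg a) (abs_nonneg b), abs_of_nonneg ha, abs_of_nonneg hb]

theorem smul_le_smul_of_le_of_nonneg {r s : R} (h : r ≤ s) {a : E} (ha : 0 ≤ a) :
    r • a ≤ s • a := by
  rw [← sub_nonneg, ← sub_smul]
  exact smul_nonneg (sub_nonneg.2 h) ha

namespace IsIdcMap

variable {ψ : E → L} (h : IsIdcMap R ψ)
include h

theorem map_mono {a b : E} (ha : 0 ≤ a) (hab : a ≤ b) : ψ a ≤ ψ b :=
  (h.2 a b ha (ha.trans hab)).2 ⟨1, zero_le_one, by simpa⟩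

theorem map_zero : ψ 0 = ⊥ := by
  obtain ⟨a, ha, hψ⟩ := h.1 ⊥
  exact le_bot_iff.1 ((h.map_mono le_rfl ha).trans_eq hψ)

theorem map_add {a b : E} (ha : 0 ≤ a) (hb : 0 ≤ b) : ψ (a + b) = ψ a ⊔ ψ b := by
  apply le_antisymm
  · obtain ⟨d, hd, hψ⟩ := h.1 (ψ a ⊔ ψ b)
    obtain ⟨r, hr, har⟩ := (h.2 a d ha hd).1 (hψ ▸ le_sup_left)
    obtain ⟨s, hs, hbs⟩ := (h.2 b d hb hd).1 (hψ ▸ le_sup_right)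
    rw [← hψ, h.2 _ _ (add_nonneg ha hb) hd]
    exact ⟨r + s, add_nonneg hr hs, by rw [add_smul]; exact add_le_add har hbs⟩
  · exact sup_le (h.map_mono ha (le_add_of_nonneg_right hb))
      (h.map_mono hb (le_add_of_nonneg_left ha))

/-- The hypothesis `hdisj` isolates the one step where scalars matter: division rings use inverses,
and `ℤ` uses induction. -/
theorem isCompletelyNormal
    (hdisj : ∀ r : R, 0 ≤ r → ∀ a b : E, 0 ≤ a → 0 ≤ b → a ⊓ b = 0 → r • a ⊓ r • b = 0) :
    IsCompletelyNormal L := by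
  intro a b
  obtain ⟨a, ha, rfl⟩ := h.1 a
  obtain ⟨b, hb, rfl⟩ := h.1 b
  have hx : 0 ≤ a - a ⊓ b := sub_nonneg.2 inf_le_left
  have hy : 0 ≤ b - a ⊓ b := sub_nonneg.2 inf_le_right
  have h0 : 0 ≤ a ⊓ b := le_inf ha hb
  refine ⟨ψ (a - a ⊓ b), ψ (b - a ⊓ b), le_antisymm ?_ ?_, le_antisymm ?_ ?_, ?_⟩
  · refine sup_le le_sup_left ?_
    rw [← h.map_add ha hy]
    refine h.map_mono hb ?_
    rw [add_sub_left_comm]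
    exact le_add_of_nonneg_right hx
  · exact sup_le_sup_left (h.map_mono hy (sub_le_self _ h0)) _
  · refine sup_le ?_ le_sup_right
    rw [← h.map_add hx hb]
    refine h.map_mono ha ?_
    rw [sub_add_eq_add_sub, add_sub_assoc]
    exact le_add_of_nonneg_right hy
  · exact sup_le_sup_right (h.map_mono hx (sub_le_self _ h0)) _
  · obtain ⟨d, hd, hψ⟩ := h.1 (ψ (a - a ⊓ b) ⊓ ψ (b - a ⊓ b))
    obtain ⟨r, hr, har⟩ := (h.2 d _ hd hx).1 (hψ ▸ inf_le_left)
    obtain ⟨s, hs, hbs⟩ := (h.2 d _ hd hy).1 (hψ ▸ inf_le_right)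
    have hxy : (a - a ⊓ b) ⊓ (b - a ⊓ b) = 0 := by rw [← inf_sub, sub_self]
    have h1 := hdisj (r + s) (add_nonneg hr hs) _ _ hx hy hxy
    have h2 : d ≤ 0 := h1 ▸ le_inf
      (har.trans (smul_le_smul_of_le_of_nonneg (le_add_of_nonneg_right hs) hx))
      (hbs.trans (smul_le_smul_of_le_of_nonneg (le_add_of_nonneg_left hr) hy))
    rw [← hψ, le_antisymm h2 hd, h.map_zero]

/-- The inequality `a ≤ r • (b + x)` gives `(a - r • b)⁺ ≤ r • x`, and conversely a bound on `(a - r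
• b)⁺` by `s • x` gives `a ≤ (r + s) • (b + x)`. -/
theorem hasCountablyBasedDifferences [Countable R] : HasCountablyBasedDifferences L := by
  intro a b
  obtain ⟨a, ha, rfl⟩ := h.1 a
  obtain ⟨b, hb, rfl⟩ := h.1 b
  refine ⟨Set.range fun r : {r : R // 0 ≤ r} => ψ ((a - r.1 • b) ⊔ 0), Set.countable_range _,
    fun x => ?_⟩
  obtain ⟨x, hx, rfl⟩ := h.1 x
  rw [← h.map_add hb hx, h.2 _ _ ha (add_nonneg hb hx), Set.exists_range_iff]
  constructor
  · rintro ⟨r, hr, hle⟩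
    refine ⟨⟨r, hr⟩, (h.2 _ _ le_sup_right hx).2 ⟨r, hr, sup_le ?_ (smul_nonneg hr hx)⟩⟩
    rwa [sub_le_iff_le_add', ← smul_add]
  · rintro ⟨⟨r, hr⟩, hle⟩
    obtain ⟨s, hs, hle⟩ := (h.2 _ _ le_sup_right hx).1 hle
    refine ⟨r + s, add_nonneg hr hs, ?_⟩
    have h1 : a ≤ r • b + s • x := sub_le_iff_le_add'.1 (le_sup_left.trans hle)
    refine h1.trans ?_
    rw [smul_add]
    exact add_le_add (smul_le_smul_of_le_of_nonneg (le_add_of_nonneg_right hs) hb)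
      (smul_le_smul_of_le_of_nonneg (le_add_of_nonneg_left hr) hx)

end IsIdcMap

theorem smul_inf_smul_eq_zero {k : Type*} [DivisionRing k] [LinearOrder k]
    [IsStrictOrderedRing k] [Module k E] [PosSMulMono k E] (r : k) (hr : 0 ≤ r) (a b : E)
    (ha : 0 ≤ a) (hb : 0 ≤ b) (hab : a ⊓ b = 0) : r • a ⊓ r • b = 0 := by
  rcases hr.eq_or_lt with rfl | h
  · simp
  · refine le_antisymm ?_ (le_inf (smul_nonneg hr ha) (smul_nonneg hr hb))
    have h1 : r⁻¹ • (r • a ⊓ r • b) ≤ a ⊓ b := le_inf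
      ((smul_le_smul_of_nonneg_left inf_le_left (inv_nonneg.2 hr)).trans_eq
        (inv_smul_smul₀ h.ne' a))
      ((smul_le_smul_of_nonneg_left inf_le_right (inv_nonneg.2 hr)).trans_eq
        (inv_smul_smul₀ h.ne' b))
    have h2 := smul_le_smul_of_nonneg_left (h1.trans_eq hab) hr
    rwa [smul_inv_smul₀ h.ne', smul_zero] at h2

theorem inf_nsmul_eq_zero {a b : E} (ha : 0 ≤ a) (hb : 0 ≤ b) (hab : a ⊓ b = 0) (n : ℕ) :
    a ⊓ n • b = 0 := by
  induction n with
  | zero => simpa using ha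
  | succ n ih =>
    refine le_antisymm ?_ (le_inf ha (nsmul_nonneg hb _))
    set z := a ⊓ (n + 1) • b
    have h1 : z - b ≤ a ⊓ n • b := by
      refine le_inf ((sub_le_self _ hb).trans inf_le_left) ?_
      rw [sub_le_iff_le_add, ← succ_nsmul]
      exact inf_le_right
    rw [ih, sub_nonpos] at h1
    exact (le_inf inf_le_left h1).trans_eq hab

theorem zsmul_inf_zsmul_eq_zero (r : ℤ) (hr : 0 ≤ r) (a b : E)
    (ha : 0 ≤ a) (hb : 0 ≤ b) (hab : a ⊓ b = 0) : r • a ⊓ r • b = 0 := by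
  lift r to ℕ using hr
  rw [natCast_zsmul, natCast_zsmul]
  refine inf_nsmul_eq_zero (nsmul_nonneg ha _) hb ?_ _
  rw [inf_comm]
  exact inf_nsmul_eq_zero hb ha (inf_comm a b ▸ hab) _

theorem IsIdcMap.int_of_rat [Module ℚ E] [PosSMulMono ℚ E] {ψ : E → L} (h : IsIdcMap ℚ ψ) :
    IsIdcMap ℤ ψ := by
  refine ⟨h.1, fun a b ha hb => (h.2 a b ha hb).trans ⟨?_, ?_⟩⟩
  · rintro ⟨r, hr, hab⟩
    refine ⟨⌈r⌉, Int.ceil_nonneg hr, hab.trans ?_⟩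
    rw [← Int.cast_smul_eq_zsmul ℚ]
    exact smul_le_smul_of_le_of_nonneg (Int.le_ceil r) hb
  · rintro ⟨r, hr, hab⟩
    exact ⟨r, by exact_mod_cast hr, by rwa [Int.cast_smul_eq_zsmul]⟩

end IdcMaps

/-! ### From a closed positivity map to a vector lattice -/

section Quotient

variable {k : Type*} [DivisionRing k] [LinearOrder k] [IsStrictOrderedRing k]
  {L : Type*} [DistribLattice L] [OrderBot L]

theorem IsPositivityMap.of_surjective {V E : Type*} [AddCommGroup V] [Module k V] [AddCommGroup E]
    [Module k E] {f : V →ₗ[k] E} (hf : Function.Surjective f) {φ : V → L} {ψ : E → L}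
    (h : ∀ a, ψ (f a) = φ a) (hφ : IsPositivityMap (k := k) ⊤ φ) :
    IsPositivityMap (k := k) ⊤ ψ where
  inf_neg := hf.forall.2 fun a _ => by rw [← map_neg, h, h, hφ.inf_neg a trivial]
  smul r hr := hf.forall.2 fun a _ => by rw [← map_smul, h, h, hφ.smul r hr a trivial]
  add_le := hf.forall.2 fun a _ => hf.forall.2 fun b _ => by
    rw [← map_add, h, h, h]; exact hφ.add_le a trivial b trivial

theorem IsClosedMap.of_surjective {V E : Type*} [AddCommGroup V] [Module k V] [AddCommGroup E]
    [Module k E] {f : V →ₗ[k] E} (hf : Function.Surjective f) {φ : V → L} {ψ : E → L}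
    (h : ∀ a, ψ (f a) = φ a) (hφ : IsClosedMap (k := k) ⊤ φ) : IsClosedMap (k := k) ⊤ ψ := by
  refine hf.forall.2 fun p _ => hf.forall.2 fun q _ c hqc hpq => ?_
  rw [← map_neg, h] at hqc
  rw [h, h] at hpq
  obtain ⟨r, hr⟩ := hφ p trivial q trivial c hqc hpq
  exact ⟨r, by rwa [← map_smul, ← map_sub, h]⟩

/-- The vectors that a positivity map identifies with zero. -/
def IsPositivityMap.ker {V : Type*} [AddCommGroup V] [Module k V] {φ : V → L}
    (hφ : IsPositivityMap (k := k) ⊤ φ) : Submodule k V where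
  carrier := {a | φ a = ⊥ ∧ φ (-a) = ⊥}
  zero_mem' := by simp [hφ.map_zero]
  add_mem' := by
    rintro a b ⟨ha, ha'⟩ ⟨hb, hb'⟩
    refine ⟨le_bot_iff.1 ((hφ.add_le a trivial b trivial).trans ?_), le_bot_iff.1
      ((hφ.le_of_eq_add (b := -a) (c := -b) trivial trivial (neg_add a b)).trans ?_)⟩
    · rw [ha, hb, sup_idem]
    · rw [ha', hb', sup_idem]
  smul_mem' := by
    rintro r a ⟨ha, ha'⟩
    refine ⟨le_bot_iff.1 ((hφ.smul_le_sup r trivial).trans ?_), ?_⟩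
    · rw [ha, ha', sup_idem]
    · rw [← neg_smul]
      refine le_bot_iff.1 ((hφ.smul_le_sup (-r) trivial).trans ?_)
      rw [ha, ha', sup_idem]

/-- The order is `x ≤ y ↔ ψ (x - y) = ⊥`, with separation giving antisymmetry, and joins come from
`a ⊔ b = b + (a - b)⁺`. -/
theorem exists_isIdcMap_of_separated {E : Type*} [AddCommGroup E] [Module k E] {ψ : E → L}
    (hψ : IsPositivityMap (k := k) ⊤ ψ) (hcl : IsClosedMap (k := k) ⊤ ψ)
    (hsep : ∀ a, ψ a = ⊥ → ψ (-a) = ⊥ → a = 0) (hsurj : ∀ c, ∃ a, ψ a = c ∧ ψ (-a) = ⊥)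
    (hpp : ∀ p, ∃ y, ψ (-y) = ⊥ ∧ ψ y = ψ p ∧ ψ (y - p) = ψ (-p) ∧ ψ (p - y) = ⊥) :
    ∃ (_ : Lattice E) (_ : IsOrderedAddMonoid E) (_ : PosSMulMono k E), IsIdcMap k ψ := by
  choose P hP1 hP2 hP3 hP4 using hpp
  have add_eq : ∀ {a b c : E}, a = b + c → ψ b = ⊥ → ψ c = ⊥ → ψ a = ⊥ := fun h hb hc =>
    le_bot_iff.1 ((hψ.le_of_eq_add trivial trivial h).trans (by rw [hb, hc, sup_idem]))
  -- The positive part is the least upper bound of `0` and `p`: the value in question lies below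
  -- both `ψ p` and `ψ (-p)`, which are disjoint.
  have hlub : ∀ p z, ψ (-z) = ⊥ → ψ (p - z) = ⊥ → ψ (P p - z) = ⊥ := by
    intro p z h1 h2
    have h3 : ψ (P p - z) ≤ ψ (P p) ⊔ ψ (-z) :=
      hψ.le_of_eq_add trivial trivial (sub_eq_add_neg _ _)
    have h4 : ψ (P p - z) ≤ ψ (P p - p) ⊔ ψ (p - z) :=
      hψ.le_of_eq_add trivial trivial (sub_add_sub_cancel _ _ _).symm
    rw [h1, sup_bot_eq, hP2] at h3
    rw [h2, sup_bot_eq, hP3] at h4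
    rw [eq_bot_iff, ← hψ.inf_neg p trivial]
    exact le_inf h3 h4
  let lat : Lattice E :=
    { le := fun x y => ψ (x - y) = ⊥
      le_refl := fun x => by simp [hψ.map_zero]
      le_trans := fun x y z h1 h2 => add_eq (sub_add_sub_cancel x y z).symm h1 h2
      le_antisymm := fun x y h1 h2 => sub_eq_zero.1 (hsep _ h1 (by rwa [neg_sub]))
      sup := fun a b => b + P (a - b)
      inf := fun a b => b - P (b - a)
      le_sup_left := fun a b => by
        rw [← sub_sub]; exact hP4 _
      le_sup_right := fun a b => by
        rw [sub_add_cancel_left]; exact hP1 _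
      sup_le := fun a b c (h1 : ψ (a - c) = ⊥) (h2 : ψ (b - c) = ⊥) => by
        have := hlub (a - b) (c - b) (by rwa [neg_sub]) (by rwa [sub_sub_sub_cancel_right])
        rwa [show b + P (a - b) - c = P (a - b) - (c - b) by abel]
      inf_le_left := fun a b => by
        rw [sub_right_comm]; exact hP4 _
      inf_le_right := fun a b => by
        rw [sub_sub_cancel_left]; exact hP1 _
      le_inf := fun a b c (h1 : ψ (a - b) = ⊥) (h2 : ψ (a - c) = ⊥) => by
        have := hlub (c - b) (c - a) (by rwa [neg_sub]) (by rwa [sub_sub_sub_cancel_left])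
        rwa [show a - (c - P (c - b)) = P (c - b) - (c - a) by abel] }
  have le_def : ∀ x y : E, x ≤ y ↔ ψ (x - y) = ⊥ := fun _ _ => Iff.rfl
  have nonneg_def : ∀ x : E, 0 ≤ x ↔ ψ (-x) = ⊥ := fun x => by rw [le_def, zero_sub]
  refine ⟨lat, ⟨fun a b h c => ?_, fun a b h c => ?_⟩, ⟨fun r hr a b h => ?_⟩, fun c => ?_,
    fun a b ha hb => ⟨fun h => ?_, ?_⟩⟩
  · rw [le_def] at h ⊢; simpa using h
  · rw [le_def] at h ⊢; simpa using h
  · rw [le_def] at h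
    rw [le_def, ← smul_sub]
    exact le_bot_iff.1 ((hψ.smul_le hr trivial).trans h.le)
  · obtain ⟨a, h1, h2⟩ := hsurj c
    exact ⟨a, (nonneg_def a).2 h2, h1⟩
  · rw [nonneg_def] at hb
    -- Closedness is used here at `c = ⊥` only; arbitrary `c` was needed to carry the construction
    -- through extensions.
    obtain ⟨r, -, hr⟩ := hcl.exists_pos hψ trivial trivial hb.le (h.trans le_sup_left)
    refine ⟨max r 0, le_max_right _ _, (le_def _ _).2 (le_bot_iff.1 (hr _ (le_max_left _ _)))⟩
  · rintro ⟨r, hr, hab⟩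
    rw [le_def] at hab
    refine (hψ.le_of_eq_add (b := a - r • b) (c := r • b) trivial trivial (by abel)).trans ?_
    rw [hab, bot_sup_eq]
    exact hψ.smul_le hr trivial

theorem exists_vectorLattice {V : Type w} [AddCommGroup V] [Module k V] {φ : V → L}
    (hφ : IsPositivityMap (k := k) ⊤ φ) (hcl : IsClosedMap (k := k) ⊤ φ)
    (hsurj : ∀ c, ∃ a, φ a = c ∧ φ (-a) = ⊥)
    (hpp : ∀ p, ∃ y, φ (-y) = ⊥ ∧ φ y = φ p ∧ φ (y - p) = φ (-p) ∧ φ (p - y) = ⊥) :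
    ∃ (E : Type w) (_ : AddCommGroup E) (_ : Lattice E) (_ : IsOrderedAddMonoid E)
      (_ : Module k E) (_ : PosSMulMono k E) (ψ : E → L), IsIdcMap k ψ := by
  have hle : ∀ a b, a - b ∈ hφ.ker → φ a ≤ φ b := fun a b hab => by
    refine (hφ.le_of_eq_add (b := b) (c := a - b) trivial trivial (by abel)).trans ?_
    rw [hab.1, sup_bot_eq]
  let ψ : V ⧸ hφ.ker → L := Quotient.lift φ fun a b hab => by
    have hab : a - b ∈ hφ.ker := (Submodule.quotientRel_def _).1 hab
    exact le_antisymm (hle a b hab) (hle b a (by rw [← neg_sub]; exact hφ.ker.neg_mem hab))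
  have hf := hφ.ker.mkQ_surjective
  have h : ∀ a, ψ (hφ.ker.mkQ a) = φ a := fun a => rfl
  obtain ⟨i1, i2, i3, hψ⟩ := exists_isIdcMap_of_separated (hφ.of_surjective hf h)
    (hcl.of_surjective hf h)
    (hf.forall.2 fun a h1 h2 => by
      rw [← map_neg, h] at h2
      exact (Submodule.Quotient.mk_eq_zero _).2 ⟨(h a).symm.trans h1, h2⟩)
    (fun c => by
      obtain ⟨a, h1, h2⟩ := hsurj c
      exact ⟨hφ.ker.mkQ a, h1, by rw [← map_neg]; exact h2⟩)
    (hf.forall.2 fun p => by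
      obtain ⟨y, h1, h2, h3, h4⟩ := hpp p
      refine ⟨hφ.ker.mkQ y, ?_, ?_, ?_, ?_⟩
      · rw [← map_neg, h, h1]
      · rw [h, h, h2]
      · rw [← map_sub, ← map_neg, h, h, h3]
      · rw [← map_sub, h, h4])
  exact ⟨V ⧸ hφ.ker, _, i1, i2, _, i3, ψ, hψ⟩

end Quotient

/-! ### Bookkeeping along `ω₁` and the representation theorem -/

section Main

open Cardinal

/-- A type with at most `ℵ₁` elements is enumerated by `ω₁` with each element occurring
cofinally often. -/
theorem exists_cofinal_enumeration (X : Type u) [Nonempty X]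
    (hX : #X ≤ aleph 1) :
    ∃ T : (aleph.{0} 1).ord.ToType → X, ∀ x j, ∃ i, j < i ∧ T i = x := by
  set I := (aleph.{0} 1).ord.ToType
  have hI : #I = aleph 1 := mk_ord_toType _
  have hcard : lift.{0} #(I × X) ≤ lift.{u} #I := by
    rw [mk_prod, lift_uzero, lift_uzero, hI, lift_aleph, Ordinal.lift_one]
    exact (mul_le_mul' le_rfl hX).trans (mul_eq_self (aleph0_le_aleph 1)).le
  obtain ⟨g⟩ := lift_mk_le'.1 hcard
  have : Nonempty I := by
    rw [← mk_ne_zero_iff, hI]; exact (aleph_pos 1).ne'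
  have hg : Function.LeftInverse (Function.invFun g) g := Function.leftInverse_invFun g.injective
  refine ⟨fun i => (Function.invFun g i).2, fun x j => ?_⟩
  by_contra! hne
  -- If `x` never occurred beyond `j`, its uncountably many codes would all lie in a countable
  -- initial segment.
  have hsub : Set.range (fun i => g (i, x)) ⊆ Set.Iic j := by
    rintro _ ⟨i, rfl⟩
    refine le_of_not_gt fun h => hne _ h ?_
    rw [hg]
  have hcount : (Set.Iic j).Countable := by
    rw [← Set.Iio_union_right]
    refine Set.Countable.union ?_ (Set.countable_singleton _)
    rw [← le_aleph0_iff_set_countable, ← lt_aleph_one_iff]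
    exact (mk_Iio_lt j (by rw [hI]; exact (Ordinal.type_toType _).symm)).trans_eq hI
  have hinj : Function.Injective fun i => g (i, x) := fun a b h => by
    simpa using g.injective h
  have : Countable I := by
    have := (hcount.mono hsub).to_subtype
    exact (Equiv.ofInjective _ hinj).injective.countable
  have h1 := mk_le_aleph0_iff.2 this
  rw [hI] at h1
  exact absurd h1 (not_le.2 aleph0_lt_aleph_one)

theorem exists_isIdcMap_of_completelyNormal (k : Type v) [DivisionRing k] [LinearOrder k]
    [IsStrictOrderedRing k] [Countable k] (L : Type u) [DistribLattice L] [OrderBot L]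
    (hL : #L ≤ aleph 1) (hCN : IsCompletelyNormal L) (hCB : HasCountablyBasedDifferences L) :
    ∃ (E : Type w) (_ : AddCommGroup E) (_ : Lattice E) (_ : IsOrderedAddMonoid E)
      (_ : Module k E) (_ : PosSMulMono k E) (ψ : E → L), IsIdcMap k ψ := by
  let I := (aleph.{0} 1).ord.ToType
  have hI : #I = aleph 1 := mk_ord_toType _
  have hIinf : Infinite I := by rw [infinite_iff, hI]; exact aleph0_le_aleph 1
  have hV : #(I →₀ k) = aleph.{v} 1 := by
    rw [mk_finsupp_lift_of_infinite, hI, lift_aleph, Ordinal.lift_one]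
    refine max_eq_left ?_
    rw [lift_uzero]
    exact (mk_le_aleph0 (α := k)).trans (aleph0_le_aleph 1)
  obtain ⟨T, hT⟩ := exists_cofinal_enumeration (L ⊕ (I →₀ k)) (by
    rw [mk_sum, hV, lift_aleph, Ordinal.lift_one]
    refine (add_le_add_left (lift_le.2 hL) _).trans ?_
    rw [lift_aleph, Ordinal.lift_one, add_eq_self (aleph0_le_aleph 1)])
  have hIio : ∀ i : I, (Set.Iio i).Countable := fun i => by
    rw [← le_aleph0_iff_set_countable, ← lt_aleph_one_iff]
    exact (mk_Iio_lt i (by rw [hI]; exact (Ordinal.type_toType _).symm)).trans_eq hI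
  obtain ⟨φ, hφ, hcl, hful⟩ := exists_positivityMap hIio hCN hCB T
  have hsurj : ∀ c, ∃ a, φ a = c ∧ φ (-a) = ⊥ := fun c => by
    obtain ⟨i, -, hi⟩ := hT (Sum.inl c) (Classical.arbitrary I)
    exact ⟨_, (hful i).2.1 c hi, (hful i).1⟩
  have hpp : ∀ p, ∃ y, φ (-y) = ⊥ ∧ φ y = φ p ∧ φ (y - p) = φ (-p) ∧ φ (p - y) = ⊥ := fun p => by
    -- The task for `p` takes effect only at an index beyond its support, which cofinal recurrence
    -- supplies.
    obtain ⟨j, hj⟩ : ∃ j : I, ∀ m ∈ p.support, m ≤ j := p.support.exists_le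
    obtain ⟨i, hji, hi⟩ := hT (Sum.inr p) j
    exact ⟨_, (hful i).1, (hful i).2.2 p hi
      ((Finsupp.mem_supported k p).2 fun m hm => (hj m hm).trans_lt hji)⟩
  -- The free space lives in the universe of `k`; shrinking it lets `E` live in an arbitrary one.
  have : Small.{w} k := Countable.toSmall k
  have : Small.{w} (I →₀ k) := small_of_injective DFunLike.coe_injective
  let f : (I →₀ k) ≃ₗ[k] Shrink.{w} (I →₀ k) := (Shrink.linearEquiv k (I →₀ k)).symm
  have hfφ : ∀ a, (φ ∘ f.symm) (f a) = φ a := fun a => by simp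
  refine exists_vectorLattice (V := Shrink.{w} (I →₀ k)) (φ := φ ∘ f.symm)
    (hφ.of_surjective (f := f.toLinearMap) f.surjective hfφ)
    (hcl.of_surjective (f := f.toLinearMap) f.surjective hfφ) (fun c => ?_)
    (f.surjective.forall.2 fun p => ?_)
  · obtain ⟨a, h1, h2⟩ := hsurj c
    exact ⟨f a, by simpa using h1, by simpa using h2⟩
  · obtain ⟨y, h⟩ := hpp p
    exact ⟨f y, by simpa using h⟩

end Main

end LRep

theorem corollary8p5 (k : Type v) [DivisionRing k] [LinearOrder k]
    [IsStrictOrderedRing k] [Countable k]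
    (L : Type u) [DistribLattice L] [OrderBot L] (hL : Cardinal.mk L ≤ Cardinal.aleph 1) :
    List.TFAE [
      ∃ (E : Type w) (_ : AddCommGroup E) (_ : Lattice E) (_ : IsOrderedAddMonoid E)
        (_ : Module k E) (_ : PosSMulMono k E), Nonempty (L ≃o LRep.Idc k E),
      ∃ (G : Type z) (_ : AddCommGroup G) (_ : Lattice G) (_ : IsOrderedAddMonoid G),
        Nonempty (L ≃o LRep.Idc ℤ G),
      LRep.IsCompletelyNormal L ∧ LRep.HasCountablyBasedDifferences L] := by
  tfae_have 1 → 3 := by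
    rintro ⟨E, _, _, _, _, _, ⟨e⟩⟩
    obtain ⟨ψ, hψ⟩ := LRep.exists_isIdcMap e
    exact ⟨hψ.isCompletelyNormal LRep.smul_inf_smul_eq_zero, hψ.hasCountablyBasedDifferences⟩
  tfae_have 2 → 3 := by
    rintro ⟨G, _, _, _, ⟨e⟩⟩
    obtain ⟨ψ, hψ⟩ := LRep.exists_isIdcMap e
    exact ⟨hψ.isCompletelyNormal LRep.zsmul_inf_zsmul_eq_zero, hψ.hasCountablyBasedDifferences⟩
  tfae_have 3 → 1 := by
    rintro ⟨h1, h2⟩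
    obtain ⟨E, i1, i2, i3, i4, i5, ψ, hψ⟩ :=
      LRep.exists_isIdcMap_of_completelyNormal.{u, v, w} k L hL h1 h2
    exact ⟨E, i1, i2, i3, i4, i5, hψ.nonempty_orderIso⟩
  tfae_have 3 → 2 := by
    rintro ⟨h1, h2⟩
    obtain ⟨G, i1, i2, i3, i4, i5, ψ, hψ⟩ :=
      LRep.exists_isIdcMap_of_completelyNormal.{u, 0, z} ℚ L hL h1 h2
    exact ⟨G, i1, i2, i3, hψ.int_of_rat.nonempty_orderIso⟩
  tfae_finish
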